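/- Let $P(M,G)$ be a smooth principal fiber bundle with projection $\pi:P\to M$, structure group a Lie group $G$ with Lie algebra $\mathfrak g$ acting on the right, $R_a(p)=pa$, and let $\omega$ be a connection form on $P$, i.e. a smooth $\mathfrak g$-valued 1-form with $\omega(B^*)=B$ for every fundamental vector field $B^*$ ($B\in\mathfrak g$) and $R_a^*\omega=\mathrm{ad}(a^{-1})\omega$ for $a\in G$. Write $\mathbf v$, $\mathbf h$ for the vertical and horizontal projections of $TP$ determined by $\omega$ and $X^h$ for the horizontal lift of a vector field $X$ on $M$. All connections below are smooth torsion-free covariant derivatives on tangent bundles. Let $\nabla^P$ be a connection on $P$ that is $G$-invariant (every $R_a$ is affine) and projectable with projection the connection $\nabla^M$ on $M$, that is, $$\mathbf h\nabla^P_{X^h}Y^h=(\nabla^M_XY)^h\quad\text{for all vector fields }X,Y\text{ on }M .$$ Let $A$ and $T$ be the fundamental tensors $$T_UV=\mathbf h\nabla^P_{\mathbf vU}\mathbf vV+\mathbf v\nabla^P_{\mathbf vU}\mathbf hV,\qquad A_UV=\mathbf v\nabla^P_{\mathbf hU}\mathbf hV+\mathbf h\nabla^P_{\mathbf hU}\mathbf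 vV,$$ with symmetric parts $A^S(U,V)=\tfrac12(A_UV+A_VU)$ and $T^S(U,V)=\tfrac12(T_UV+T_VU)$. Let $N$ be a Riemannian manifold with metric $g$ and Levi-Civita connection $\nabla^g$, and let $\mathrm{tr}$ denote the trace with respect to $g$. For a smooth map $f$ from $N$ to a manifold $Q$ with connection $\nabla^Q$, the tension field is $\tau_f=\mathrm{tr}\,\beta_f$, where $\beta_f(X,Y)=\nabla^{f}_X(f_*Y)-f_*(\nabla^g_XY)$ and $\nabla^f$ is the pullback of $\nabla^Q$ along $f$; $f$ is harmonic if $\tau_f=0$. For a vector-valued 1-form $\alpha$, $(\nabla\alpha)(X,Y)=X(\alpha(Y))-\alpha(\nabla_XY)$, and $d^*\alpha=\mathrm{tr}\,\nabla^g\alpha$ for $\alpha$ on $N$ (note the sign). Then a smooth map $F:N\to P$ is harmonic (with respect to $g$ and $\nabla^P$) if and only if both $$d^*F^*\omega=\mathrm{tr}\,F^*(\nabla^P\omega)$$ and $$\tau_{\pi\circ F}=-\mathrm{tr}\;\pi_*\circ(2A^S+T^S)\circ(F_*\otimes F_*)$$ hold on $N$, where $\tau_{\pi\circ F}$ is taken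 with respect to $g$ and $\nabla^M$. -/

import Mathlib

open Bundle Manifold ContDiff

noncomputable section

namespace PrincipalHarmonic

/-! ### The metric trace and the Levi-Civita connection of a Riemannian metric -/

section LeviCivita
variable {E : Type*} [NormedAddCommGroup E] [NormedSpace ℝ E]
  {N : Type*} [TopologicalSpace N] [ChartedSpace E N] [IsManifold 𝓘(ℝ, E) ∞ N]
  (g : ContMDiffRiemannianMetric 𝓘(ℝ, E) ∞ E (TangentSpace 𝓘(ℝ, E) : N → Type _))

lemma metric_mdifferentiableAt {X Y : Π x : N, TangentSpace 𝓘(ℝ, E) x} {x : N}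
    (hX : MDiffAt (T% X) x) (hY : MDiffAt (T% Y) x) :
    MDiffAt (fun y ↦ g.inner y (X y) (Y y)) x := by
  have : MDifferentiableAt 𝓘(ℝ, E) (𝓘(ℝ, E).prod 𝓘(ℝ))
      (fun m ↦ TotalSpace.mk' ℝ (E := Bundle.Trivial N ℝ) m (g.inner m (X m) (Y m))) x := by
    apply MDifferentiableAt.clm_bundle_apply₂ (F₁ := E) (F₂ := E)
    · exact (g.contMDiff.mdifferentiableAt (by simp))
    · exact hX
    · exact hY
  simp only [mdifferentiableAt_totalSpace] at this
  exact this.2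

theorem exists_orthonormal_basis [FiniteDimensional ℝ E] (x : N) :
    ∃ e : Module.Basis (Fin (Module.finrank ℝ E)) ℝ (TangentSpace 𝓘(ℝ, E) x),
      ∀ i j, g.inner x (e i) (e j) = if i = j then 1 else 0 := by
  let _ : RiemannianBundle (TangentSpace 𝓘(ℝ, E) : N → Type _) := ⟨g.toRiemannianMetric⟩
  have : FiniteDimensional ℝ (TangentSpace 𝓘(ℝ, E) x) := inferInstanceAs (FiniteDimensional ℝ E)
  let b := (stdOrthonormalBasis ℝ (TangentSpace 𝓘(ℝ, E) x))
  have h : Module.finrank ℝ (TangentSpace 𝓘(ℝ, E) x) = Module.finrank ℝ E := rfl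
  refine ⟨b.toBasis.reindex (finCongr h), fun i j ↦ ?_⟩
  have := orthonormal_iff_ite.1 b.orthonormal i j
  exact this

/-- The right-hand side of the Koszul formula for `2 g(∇_X Y, Z)`. -/
def koszul (X Y Z : Π x : N, TangentSpace 𝓘(ℝ, E) x) (x : N) : ℝ :=
  mvfderiv 𝓘(ℝ, E) (fun y ↦ g.inner y (Y y) (Z y)) x (X x)
    + mvfderiv 𝓘(ℝ, E) (fun y ↦ g.inner y (X y) (Z y)) x (Y x)
    - mvfderiv 𝓘(ℝ, E) (fun y ↦ g.inner y (X y) (Y y)) x (Z x)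
    + g.inner x (VectorField.mlieBracket 𝓘(ℝ, E) X Y x) (Z x)
    - g.inner x (VectorField.mlieBracket 𝓘(ℝ, E) X Z x) (Y x)
    - g.inner x (VectorField.mlieBracket 𝓘(ℝ, E) Y Z x) (X x)

variable [FiniteDimensional ℝ E] {g}
variable {X X' Y Y' Z Z' : Π x : N, TangentSpace 𝓘(ℝ, E) x} {f : N → ℝ} {x : N}
lemma koszul_add_left (hX : MDiffAt (T% X) x) (hX' : MDiffAt (T% X') x) (hY : MDiffAt (T% Y) x)
    (hZ : MDiffAt (T% Z) x) :
    koszul g (X + X') Y Z x = koszul g X Y Z x + koszul g X' Y Z x := by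
  have := FiniteDimensional.complete ℝ E
  simp [koszul, VectorField.mlieBracket_add_left hX hX',
    mvfderiv_fun_add (metric_mdifferentiableAt g hX hY) (metric_mdifferentiableAt g hX' hY),
    mvfderiv_fun_add (metric_mdifferentiableAt g hX hZ) (metric_mdifferentiableAt g hX' hZ)]
  ring

lemma koszul_smul_left (hf : MDiffAt f x) (hX : MDiffAt (T% X) x) (hY : MDiffAt (T% Y) x)
    (hZ : MDiffAt (T% Z) x) :
    koszul g (f • X) Y Z x = f x * koszul g X Y Z x := by
  have := FiniteDimensional.complete ℝ E
  simp [koszul, VectorField.mlieBracket_smul_left hf hX, 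
    mvfderiv_fun_mul hf (metric_mdifferentiableAt g hX hY),
    mvfderiv_fun_mul hf (metric_mdifferentiableAt g hX hZ)]
  ring

lemma koszul_add_right (hX : MDiffAt (T% X) x) (hY : MDiffAt (T% Y) x)
    (hZ : MDiffAt (T% Z) x) (hZ' : MDiffAt (T% Z') x) :
    koszul g X Y (Z + Z') x = koszul g X Y Z x + koszul g X Y Z' x := by
  have := FiniteDimensional.complete ℝ E
  simp [koszul, VectorField.mlieBracket_add_right hZ hZ',
    mvfderiv_fun_add (metric_mdifferentiableAt g hX hZ) (metric_mdifferentiableAt g hX hZ'),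
    mvfderiv_fun_add (metric_mdifferentiableAt g hY hZ) (metric_mdifferentiableAt g hY hZ')]
  ring

lemma koszul_smul_right (hf : MDiffAt f x) (hX : MDiffAt (T% X) x) (hY : MDiffAt (T% Y) x)
    (hZ : MDiffAt (T% Z) x) :
    koszul g X Y (f • Z) x = f x * koszul g X Y Z x := by
  have := FiniteDimensional.complete ℝ E
  simp [koszul, VectorField.mlieBracket_smul_right hf hZ,
    mvfderiv_fun_mul hf (metric_mdifferentiableAt g hX hZ),
    mvfderiv_fun_mul hf (metric_mdifferentiableAt g hY hZ)]
  rw [g.symm x (Z x) (Y x), g.symm x (Z x) (X x)]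
  ring

lemma koszul_add_middle (hX : MDiffAt (T% X) x) (hY : MDiffAt (T% Y) x) (hY' : MDiffAt (T% Y') x)
    (hZ : MDiffAt (T% Z) x) :
    koszul g X (Y + Y') Z x = koszul g X Y Z x + koszul g X Y' Z x := by
  have := FiniteDimensional.complete ℝ E
  simp [koszul, VectorField.mlieBracket_add_left hY hY', VectorField.mlieBracket_add_right hY hY',
    mvfderiv_fun_add (metric_mdifferentiableAt g hX hY) (metric_mdifferentiableAt g hX hY'),
    mvfderiv_fun_add (metric_mdifferentiableAt g hY hZ) (metric_mdifferentiableAt g hY' hZ)]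
  ring

lemma koszul_smul_middle (hf : MDiffAt f x) (hX : MDiffAt (T% X) x) (hY : MDiffAt (T% Y) x)
    (hZ : MDiffAt (T% Z) x) :
    koszul g X (f • Y) Z x
      = f x * koszul g X Y Z x + 2 * (mvfderiv 𝓘(ℝ, E) f x (X x) * g.inner x (Y x) (Z x)) := by
  have := FiniteDimensional.complete ℝ E
  simp [koszul, VectorField.mlieBracket_smul_right hf hY, VectorField.mlieBracket_smul_left hf hY,
    mvfderiv_fun_mul hf (metric_mdifferentiableAt g hX hY),
    mvfderiv_fun_mul hf (metric_mdifferentiableAt g hY hZ)]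
  rw [g.symm x (Y x) (X x)]
  ring

variable (g) in
open Classical in
/-- For a vector field `Y` differentiable at `x`, the bilinear form
`(Z, X) ↦ koszul g X Y Z x` on the tangent space at `x`. -/
def koszulForm (Y : Π x : N, TangentSpace 𝓘(ℝ, E) x) (x : N) :
    TangentSpace 𝓘(ℝ, E) x →L[ℝ] TangentSpace 𝓘(ℝ, E) x →L[ℝ] ℝ :=
  if hY : MDiffAt (T% Y) x then
    TensorialAt.mkHom₂ (I := 𝓘(ℝ, E)) (F := E) (F' := E) (fun Z X ↦ koszul g X Y Z x) x
      (fun _ hX ↦ ⟨fun hf hZ ↦ koszul_smul_right hf hX hY hZ,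
        fun hZ hZ' ↦ koszul_add_right hX hY hZ hZ'⟩)
      (fun _ hZ ↦ ⟨fun hf hX ↦ koszul_smul_left hf hX hY hZ,
        fun hX hX' ↦ koszul_add_left hX hX' hY hZ⟩)
  else 0

lemma koszulForm_apply (hX : MDiffAt (T% X) x) (hY : MDiffAt (T% Y) x) (hZ : MDiffAt (T% Z) x) :
    koszulForm g Y x (Z x) (X x) = koszul g X Y Z x := by
  rw [koszulForm, dif_pos hY]
  exact TensorialAt.mkHom₂_apply _ _ hZ hX

variable (g) in
/-- A basis of the tangent space at `x` that is orthonormal for the metric `g`. -/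
def orthonormalBasis (x : N) : Module.Basis (Fin (Module.finrank ℝ E)) ℝ (TangentSpace 𝓘(ℝ, E) x) :=
  (exists_orthonormal_basis g x).choose

lemma inner_orthonormalBasis (x : N) (i j : Fin (Module.finrank ℝ E)) :
    g.inner x (orthonormalBasis g x i) (orthonormalBasis g x j) = if i = j then 1 else 0 :=
  (exists_orthonormal_basis g x).choose_spec i j

lemma sum_inner_orthonormalBasis (x : N) (v : TangentSpace 𝓘(ℝ, E) x) :
    ∑ i, g.inner x v (orthonormalBasis g x i) • orthonormalBasis g x i = v := by
  conv_rhs => rw [← (orthonormalBasis g x).sum_repr v]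
  refine Finset.sum_congr rfl fun i _ ↦ ?_
  congr 1
  conv_lhs => rw [← (orthonormalBasis g x).sum_repr v]
  rw [map_sum]
  simp only [map_smul, sum_apply, smul_apply, inner_orthonormalBasis]
  simp

variable (g) in
/-- The Levi-Civita connection of `g`: the covariant derivative given by the Koszul formula
(see `two_mul_inner_leviCivita`, `leviCivita_metric` and `leviCivita_torsion`). -/
def leviCivita : CovariantDerivative 𝓘(ℝ, E) E (TangentSpace 𝓘(ℝ, E) : N → Type _) where
  toFun Y x := (2⁻¹ : ℝ) • ∑ i, (koszulForm g Y x (orthonormalBasis g x i)).smulRight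
    (orthonormalBasis g x i)
  isCovariantDerivativeOnUniv :=
    { add := by
        intro Y Y' x hY hY' _
        ext u
        have key : ∀ Z₀, koszulForm g (Y + Y') x Z₀ u
            = koszulForm g Y x Z₀ u + koszulForm g Y' x Z₀ u := by
          intro Z₀
          have hu := FiberBundle.mdifferentiableAt_extend 𝓘(ℝ, E) E u
          have hZ := FiberBundle.mdifferentiableAt_extend 𝓘(ℝ, E) E Z₀
          have h1 := koszulForm_apply (g := g) hu (mdifferentiableAt_add_section hY hY') hZ
          have h2 := koszulForm_apply (g := g) hu hY hZ
          have h3 := koszulForm_apply (g := g) hu hY' hZ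
          rw [koszul_add_middle hu hY hY' hZ, ← h2, ← h3] at h1
          simpa using h1
        simp [key, add_smul, Finset.sum_add_distrib]
      leibniz := by
        intro Y f x hY hf _
        ext u
        have key : ∀ Z₀, koszulForm g (f • Y) x Z₀ u
            = f x * koszulForm g Y x Z₀ u + 2 * (mvfderiv 𝓘(ℝ, E) f x u * g.inner x (Y x) Z₀) := by
          intro Z₀
          have hu := FiberBundle.mdifferentiableAt_extend 𝓘(ℝ, E) E u
          have hZ := FiberBundle.mdifferentiableAt_extend 𝓘(ℝ, E) E Z₀
          have h1 := koszulForm_apply (g := g) hu (hf.smul_section hY) hZ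
          have h2 := koszulForm_apply (g := g) hu hY hZ
          rw [koszul_smul_middle hf hu hY hZ, ← h2] at h1
          simpa using h1
        simp only [key, smul_apply, sum_apply,
          ContinuousLinearMap.smulRight_apply, add_smul, mul_smul,
          Finset.sum_add_distrib, ← Finset.smul_sum, sum_inner_orthonormalBasis, smul_add,
          add_apply]
        rw [smul_comm (2⁻¹ : ℝ) (f x)]
        simp }

lemma two_mul_inner_leviCivita (hX : MDiffAt (T% X) x) (hY : MDiffAt (T% Y) x)
    (hZ : MDiffAt (T% Z) x) :
    2 * g.inner x (leviCivita g Y x (X x)) (Z x) = koszul g X Y Z x := by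
  rw [← koszulForm_apply hX hY hZ]
  have : leviCivita g Y x (X x) = (2⁻¹ : ℝ) • ∑ i, koszulForm g Y x (orthonormalBasis g x i) (X x) •
    (orthonormalBasis g x i) := by simp [leviCivita]
  rw [this]
  conv_rhs => rw [← sum_inner_orthonormalBasis (g := g) x (Z x)]
  simp only [map_smul, map_sum, smul_apply, sum_apply, smul_eq_mul]
  rw [← mul_assoc]
  norm_num
  refine Finset.sum_congr rfl fun i _ ↦ ?_
  rw [g.symm x _ (Z x), mul_comm]

theorem leviCivita_metric (hX : MDiffAt (T% X) x) (hY : MDiffAt (T% Y) x)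
    (hZ : MDiffAt (T% Z) x) :
    mvfderiv 𝓘(ℝ, E) (fun y ↦ g.inner y (Y y) (Z y)) x (X x)
      = g.inner x (leviCivita g Y x (X x)) (Z x) + g.inner x (Y x) (leviCivita g Z x (X x)) := by
  have h1 := two_mul_inner_leviCivita (g := g) hX hY hZ
  have h2 := two_mul_inner_leviCivita (g := g) hX hZ hY
  rw [g.symm x (Y x)]
  have h3 : koszul g X Y Z x + koszul g X Z Y x
      = 2 * mvfderiv 𝓘(ℝ, E) (fun y ↦ g.inner y (Y y) (Z y)) x (X x) := by
    have : (fun y ↦ g.inner y (Y y) (Z y)) = (fun y ↦ g.inner y (Z y) (Y y)) :=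
      funext fun y ↦ g.symm y _ _
    simp only [koszul, this]
    rw [VectorField.mlieBracket_swap (V := Z) (W := Y)]
    simp
    ring
  linarith

theorem leviCivita_torsion_apply (hX : MDiffAt (T% X) x) (hY : MDiffAt (T% Y) x) :
    leviCivita g Y x (X x) - leviCivita g X x (Y x) = VectorField.mlieBracket 𝓘(ℝ, E) X Y x := by
  have key : ∀ Z₀, g.inner x (leviCivita g Y x (X x) - leviCivita g X x (Y x)) Z₀
      = g.inner x (VectorField.mlieBracket 𝓘(ℝ, E) X Y x) Z₀ := by
    intro Z₀
    have hZ := FiberBundle.mdifferentiableAt_extend 𝓘(ℝ, E) E Z₀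
    have h1 := two_mul_inner_leviCivita (g := g) hX hY hZ
    have h2 := two_mul_inner_leviCivita (g := g) hY hX hZ
    have : (fun y ↦ g.inner y (Y y) (X y)) = (fun y ↦ g.inner y (X y) (Y y)) :=
      funext fun y ↦ g.symm y _ _
    simp only [koszul, this, FiberBundle.extend_apply_self] at h1 h2
    rw [VectorField.mlieBracket_swap (V := Y) (W := X)] at h2
    simp at h2
    simp
    linarith
  have key0 : ∀ Z₀, g.inner x (leviCivita g Y x (X x) - leviCivita g X x (Y x)
      - VectorField.mlieBracket 𝓘(ℝ, E) X Y x) Z₀ = 0 := by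
    intro Z₀
    rw [map_sub, sub_apply, key, sub_self]
  rw [← sub_eq_zero]
  by_contra hne
  exact (g.pos x _ hne).ne' (key0 _)

theorem leviCivita_torsion : (leviCivita g).torsion = 0 := by
  have := FiniteDimensional.complete ℝ E
  rw [CovariantDerivative.torsion_eq_zero_iff]
  intro X Y x hX hY
  exact leviCivita_torsion_apply hX hY

variable (g) in
/-- The trace with respect to `g` of a bilinear map `b` on the tangent space at `x`, computed in an
orthonormal basis. -/
def metricTrace {W : Type*} [AddCommGroup W] (x : N)
    (b : TangentSpace 𝓘(ℝ, E) x → TangentSpace 𝓘(ℝ, E) x → W) : W :=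
  ∑ i, b (orthonormalBasis g x i) (orthonormalBasis g x i)

end LeviCivita

/-! ### Connections, second fundamental forms and tension fields -/

section Connections

variable {E : Type*} [NormedAddCommGroup E] [NormedSpace ℝ E]
  {N : Type*} [TopologicalSpace N] [ChartedSpace E N] [IsManifold 𝓘(ℝ, E) ∞ N]
  {E' : Type*} [NormedAddCommGroup E'] [NormedSpace ℝ E']
  {P : Type*} [TopologicalSpace P] [ChartedSpace E' P] [IsManifold 𝓘(ℝ, E') ∞ P]

/-- A connection on a manifold: a smooth torsion-free covariant derivative on the tangent bundle.
(`cov Y x u` is `∇_u Y` at `x`.) -/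
structure IsConnection [FiniteDimensional ℝ E] [CompleteSpace E]
    (cov : CovariantDerivative 𝓘(ℝ, E) E (TangentSpace 𝓘(ℝ, E) : N → Type _)) : Prop where
  smooth : CovariantDerivative.ContMDiffCovariantDerivative cov ∞
  torsion_free : cov.torsion = 0

/-- The pullback connection: `pullbackCov cov F V x u` is the covariant derivative at `x`, in the
direction `u`, of the vector field `V` along `F`. In the local trivialization `t` of the tangent
bundle of `P` around `F x`, with constant local frame `s`, write `V = ∑ wⁱ (sᵢ ∘ F)`; then
`∇_u V = ∑ dwⁱ(u) sᵢ + ∑ wⁱ(x) ∇_{F_* u} sᵢ`. The section `FiberBundle.extend E' (V x)` is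
`∑ wⁱ(x) sᵢ`. -/
def pullbackCov (cov : CovariantDerivative 𝓘(ℝ, E') E' (TangentSpace 𝓘(ℝ, E') : P → Type _))
    (F : N → P) (V : Π y : N, TangentSpace 𝓘(ℝ, E') (F y)) (x : N) (u : TangentSpace 𝓘(ℝ, E) x) :
    TangentSpace 𝓘(ℝ, E') (F x) :=
  let t := trivializationAt E' (TangentSpace 𝓘(ℝ, E') : P → Type _) (F x)
  t.symm (F x) (mvfderiv 𝓘(ℝ, E) (fun y ↦ (t ⟨F y, V y⟩).2) x u)
    + cov (FiberBundle.extend E' (V x)) (F x) (mfderiv 𝓘(ℝ, E) 𝓘(ℝ, E') F x u)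

/-- The second fundamental form `β_F(u, v) = ∇_u (F_* V) - F_* (∇_u V)` of a map `F` between
manifolds with connections, where `V` is a vector field extending `v`. -/
def secondFundamentalForm
    (cov : CovariantDerivative 𝓘(ℝ, E) E (TangentSpace 𝓘(ℝ, E) : N → Type _))
    (cov' : CovariantDerivative 𝓘(ℝ, E') E' (TangentSpace 𝓘(ℝ, E') : P → Type _))
    (F : N → P) (x : N) (u v : TangentSpace 𝓘(ℝ, E) x) : TangentSpace 𝓘(ℝ, E') (F x) :=
  pullbackCov cov' F (fun y ↦ mfderiv 𝓘(ℝ, E) 𝓘(ℝ, E') F y (FiberBundle.extend E v y)) x u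
    - mfderiv 𝓘(ℝ, E) 𝓘(ℝ, E') F x (cov (FiberBundle.extend E v) x u)

/-- A map is affine if its second fundamental form vanishes. -/
def IsAffineMap
    (cov : CovariantDerivative 𝓘(ℝ, E) E (TangentSpace 𝓘(ℝ, E) : N → Type _))
    (cov' : CovariantDerivative 𝓘(ℝ, E') E' (TangentSpace 𝓘(ℝ, E') : P → Type _))
    (F : N → P) : Prop :=
  ∀ (x : N) (u v : TangentSpace 𝓘(ℝ, E) x), secondFundamentalForm cov cov' F x u v = 0

/-- The covariant derivative `(∇α)(u, v) = u(α(V)) - α(∇_u V)` of a vector-valued 1-form `α`, where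
`V` is a vector field extending `v`. -/
def covDerivForm {W : Type*} [NormedAddCommGroup W] [NormedSpace ℝ W]
    (cov : CovariantDerivative 𝓘(ℝ, E) E (TangentSpace 𝓘(ℝ, E) : N → Type _))
    (α : Π x : N, TangentSpace 𝓘(ℝ, E) x →L[ℝ] W) (x : N) (u v : TangentSpace 𝓘(ℝ, E) x) : W :=
  mvfderiv 𝓘(ℝ, E) (fun y ↦ α y (FiberBundle.extend E v y)) x u
    - α x (cov (FiberBundle.extend E v) x u)

variable [FiniteDimensional ℝ E]
  (g : ContMDiffRiemannianMetric 𝓘(ℝ, E) ∞ E (TangentSpace 𝓘(ℝ, E) : N → Type _))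

/-- The operator `d^*` on vector-valued 1-forms, with the sign convention `d^*α = tr_g ∇α`. -/
def dStar {W : Type*} [NormedAddCommGroup W] [NormedSpace ℝ W]
    (α : Π x : N, TangentSpace 𝓘(ℝ, E) x →L[ℝ] W) (x : N) : W :=
  metricTrace g x (covDerivForm (leviCivita g) α x)

/-- The tension field `τ_F = tr_g β_F` of a map from a Riemannian manifold to a manifold with
connection. -/
def tensionField (cov' : CovariantDerivative 𝓘(ℝ, E') E' (TangentSpace 𝓘(ℝ, E') : P → Type _))
    (F : N → P) (x : N) : TangentSpace 𝓘(ℝ, E') (F x) :=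
  metricTrace g x (secondFundamentalForm (leviCivita g) cov' F x)

/-- A map is harmonic if its tension field vanishes. -/
def IsHarmonic (cov' : CovariantDerivative 𝓘(ℝ, E') E' (TangentSpace 𝓘(ℝ, E') : P → Type _))
    (F : N → P) : Prop :=
  ∀ x, tensionField g cov' F x = 0

end Connections

/-! ### Principal bundles and connection forms -/

section Principal

variable (EM EP EG : Type*) [NormedAddCommGroup EM] [NormedSpace ℝ EM]
  [NormedAddCommGroup EP] [NormedSpace ℝ EP] [NormedAddCommGroup EG] [NormedSpace ℝ EG]
  (M P G : Type*) [TopologicalSpace M] [ChartedSpace EM M]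
  [TopologicalSpace P] [ChartedSpace EP P]
  [TopologicalSpace G] [ChartedSpace EG G] [Group G]

/-- A smooth principal fiber bundle `P(M, G)`: a smooth projection `proj : P → M`, a smooth right
action `act` of `G` on `P` over `M`, and local equivariant trivializations. -/
structure PrincipalBundle where
  proj : P → M
  act : P → G → P
  contMDiff_proj : ContMDiff 𝓘(ℝ, EP) 𝓘(ℝ, EM) ∞ proj
  contMDiff_act : ContMDiff (𝓘(ℝ, EP).prod 𝓘(ℝ, EG)) 𝓘(ℝ, EP) ∞ (fun z : P × G ↦ act z.1 z.2)
  act_one : ∀ p, act p 1 = p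
  act_mul : ∀ p a b, act p (a * b) = act (act p a) b
  proj_act : ∀ p a, proj (act p a) = proj p
  locally_trivial : ∀ x : M, ∃ (U : Set M) (ψ : OpenPartialHomeomorph P (M × G)),
    IsOpen U ∧ x ∈ U ∧ ψ.source = proj ⁻¹' U ∧ ψ.target = U ×ˢ Set.univ ∧
    ContMDiffOn 𝓘(ℝ, EP) (𝓘(ℝ, EM).prod 𝓘(ℝ, EG)) ∞ ψ ψ.source ∧
    ContMDiffOn (𝓘(ℝ, EM).prod 𝓘(ℝ, EG)) 𝓘(ℝ, EP) ∞ ψ.symm ψ.target ∧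
    (∀ p ∈ ψ.source, (ψ p).1 = proj p) ∧
    (∀ p ∈ ψ.source, ∀ a, (ψ (act p a)).2 = (ψ p).2 * a)

variable {EM EP EG M P G}

/-- The action is free. -/
lemma PrincipalBundle.act_free (B : PrincipalBundle EM EP EG M P G) {p : P} {a : G}
    (h : B.act p a = p) : a = 1 := by
  obtain ⟨U, ψ, -, hx, hs, -, -, -, -, h2⟩ := B.locally_trivial (B.proj p)
  have hp : p ∈ ψ.source := by rw [hs]; exact hx
  have := h2 p hp a
  rw [h] at this
  simpa using this.symm

/-- The fibers of the projection are the orbits of the action. -/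
lemma PrincipalBundle.exists_act_eq (B : PrincipalBundle EM EP EG M P G) {p q : P}
    (h : B.proj p = B.proj q) : ∃ a, B.act p a = q := by
  obtain ⟨U, ψ, -, hx, hs, -, -, -, h1, h2⟩ := B.locally_trivial (B.proj p)
  have hp : p ∈ ψ.source := by rw [hs]; exact hx
  have hq : q ∈ ψ.source := by rw [hs]; rw [h] at hx; exact hx
  have ha : B.act p ((ψ p).2⁻¹ * (ψ q).2) ∈ ψ.source := by
    rw [hs, Set.mem_preimage, B.proj_act]; exact hx
  refine ⟨(ψ p).2⁻¹ * (ψ q).2, ψ.injOn ha hq (Prod.ext ?_ ?_)⟩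
  · rw [h1 _ ha, h1 _ hq, B.proj_act, h]
  · rw [h2 p hp]; group

/-- The projection is onto. -/
lemma PrincipalBundle.proj_surjective (B : PrincipalBundle EM EP EG M P G) :
    Function.Surjective B.proj := by
  intro x
  obtain ⟨U, ψ, -, hx, -, ht, -, -, h1, -⟩ := B.locally_trivial x
  have hz : (x, (1 : G)) ∈ ψ.target := by rw [ht]; exact ⟨hx, trivial⟩
  refine ⟨ψ.symm (x, 1), ?_⟩
  rw [← h1 _ (ψ.map_target hz), ψ.right_inv hz]

/-- The value at `p` of the fundamental vector field of an element of the Lie algebra: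
the velocity at time `0` of `p · exp(tξ)`. -/
def PrincipalBundle.fundamental (B : PrincipalBundle EM EP EG M P G) (p : P) :
    GroupLieAlgebra 𝓘(ℝ, EG) G →L[ℝ] TangentSpace 𝓘(ℝ, EP) p :=
  (mfderiv 𝓘(ℝ, EG) 𝓘(ℝ, EP) (fun a : G ↦ B.act p a) 1 :)

/-- The adjoint action of `a` on the Lie algebra: the derivative at `1` of `x ↦ a x a⁻¹`. -/
def adjointAction (a : G) : GroupLieAlgebra 𝓘(ℝ, EG) G →L[ℝ] GroupLieAlgebra 𝓘(ℝ, EG) G :=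
  (mfderiv 𝓘(ℝ, EG) 𝓘(ℝ, EG) (fun x : G ↦ a * x * a⁻¹) 1 :)

variable [IsManifold 𝓘(ℝ, EM) ∞ M] [IsManifold 𝓘(ℝ, EP) ∞ P]

/-- A connection form on a principal bundle: a smooth Lie algebra valued 1-form `θ` with
`θ(ξ^*) = ξ` and `R_a^* θ = ad(a⁻¹) θ`. -/
structure ConnectionForm (B : PrincipalBundle EM EP EG M P G) where
  form : Π p : P, TangentSpace 𝓘(ℝ, EP) p →L[ℝ] GroupLieAlgebra 𝓘(ℝ, EG) G
  smooth : ContMDiff 𝓘(ℝ, EP).tangent 𝓘(ℝ, EG) (M' := EG) ∞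
    (fun v : TangentBundle 𝓘(ℝ, EP) P ↦ form v.proj v.snd)
  form_fundamental : ∀ p ξ, form p (B.fundamental p ξ) = ξ
  form_act : ∀ (a : G) (p : P) (u : TangentSpace 𝓘(ℝ, EP) p),
    form (B.act p a) (mfderiv 𝓘(ℝ, EP) 𝓘(ℝ, EP) (fun q ↦ B.act q a) p u)
      = adjointAction (EG := EG) a⁻¹ (form p u)

namespace ConnectionForm

variable {B : PrincipalBundle EM EP EG M P G} (θ : ConnectionForm B)

/-- The vertical part of a tangent vector. -/
def ver (p : P) (u : TangentSpace 𝓘(ℝ, EP) p) : TangentSpace 𝓘(ℝ, EP) p :=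
  B.fundamental p (θ.form p u)

/-- The horizontal part of a tangent vector. -/
def hor (p : P) (u : TangentSpace 𝓘(ℝ, EP) p) : TangentSpace 𝓘(ℝ, EP) p :=
  u - θ.ver p u

/-- The horizontal lift to `p` of a tangent vector `v` of `M` at `π(p)`: the unique tangent vector
with `π_* = v` and `θ = 0`. (The linear map `(π_*, θ)` on the tangent space at `p` is invertible.) -/
def lift (p : P) (v : TangentSpace 𝓘(ℝ, EM) (B.proj p)) : TangentSpace 𝓘(ℝ, EP) p :=
  ((mfderiv 𝓘(ℝ, EP) 𝓘(ℝ, EM) B.proj p).prod (θ.form p)).inverse (v, 0)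

variable (cov : CovariantDerivative 𝓘(ℝ, EP) EP (TangentSpace 𝓘(ℝ, EP) : P → Type _))

/-- The fundamental tensor `T_U V = h ∇_{vU} vV + v ∇_{vU} hV`. -/
def tensorT (p : P) (u v : TangentSpace 𝓘(ℝ, EP) p) : TangentSpace 𝓘(ℝ, EP) p :=
  θ.hor p (cov (fun q ↦ θ.ver q (FiberBundle.extend EP v q)) p (θ.ver p u))
    + θ.ver p (cov (fun q ↦ θ.hor q (FiberBundle.extend EP v q)) p (θ.ver p u))

/-- The fundamental tensor `A_U V = v ∇_{hU} hV + h ∇_{hU} vV`. -/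
def tensorA (p : P) (u v : TangentSpace 𝓘(ℝ, EP) p) : TangentSpace 𝓘(ℝ, EP) p :=
  θ.ver p (cov (fun q ↦ θ.hor q (FiberBundle.extend EP v q)) p (θ.hor p u))
    + θ.hor p (cov (fun q ↦ θ.ver q (FiberBundle.extend EP v q)) p (θ.hor p u))

/-- The symmetric part `T^S(u, v) = (T_u v + T_v u) / 2`. -/
def symT (p : P) (u v : TangentSpace 𝓘(ℝ, EP) p) : TangentSpace 𝓘(ℝ, EP) p :=
  (2⁻¹ : ℝ) • (θ.tensorT cov p u v + θ.tensorT cov p v u)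

/-- The symmetric part `A^S(u, v) = (A_u v + A_v u) / 2`. -/
def symA (p : P) (u v : TangentSpace 𝓘(ℝ, EP) p) : TangentSpace 𝓘(ℝ, EP) p :=
  (2⁻¹ : ℝ) • (θ.tensorA cov p u v + θ.tensorA cov p v u)

/-- The covariant derivative `∇θ` of the connection form. -/
def covDeriv (p : P) (u v : TangentSpace 𝓘(ℝ, EP) p) : EG :=
  covDerivForm (W := EG) cov (fun q ↦ θ.form q) p u v

/-- The pullback `F^* θ` of the connection form by a map into `P`. -/
def pullback {EN N : Type*} [NormedAddCommGroup EN] [NormedSpace ℝ EN] [TopologicalSpace N]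
    [ChartedSpace EN N] (F : N → P) (x : N) : TangentSpace 𝓘(ℝ, EN) x →L[ℝ] EG :=
  ((θ.form (F x)).comp (mfderiv 𝓘(ℝ, EN) 𝓘(ℝ, EP) F x) :)

/-- `cov` is a `G`-invariant connection on `P` that is projectable with projection `covM`:
right translations are affine, and `h ∇_{X^h} Y^h = (∇^M_X Y)^h` for all vector fields `X`, `Y`
on `M`. -/
structure IsProjectable
    (covM : CovariantDerivative 𝓘(ℝ, EM) EM (TangentSpace 𝓘(ℝ, EM) : M → Type _)) : Prop where
  invariant : ∀ a : G, IsAffineMap cov cov (fun p ↦ B.act p a)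
  projection : ∀ X Y : Π x : M, TangentSpace 𝓘(ℝ, EM) x, CMDiff ∞ (T% X) → CMDiff ∞ (T% Y) →
    ∀ p : P, θ.hor p (cov (fun q ↦ θ.lift q (Y (B.proj q))) p (θ.lift p (X (B.proj p))))
      = θ.lift p (covM Y (B.proj p) (X (B.proj p)))

end ConnectionForm

end Principal

end PrincipalHarmonic

end

open PrincipalHarmonic

/-! The pair `(π_*, ω)` is injective on each tangent space of `P`: a vector killed by `π_*` is
fundamental, and `ω` recovers its generator. Hence `τ_F = 0` if and only if `ω(τ_F) = 0` and `π_*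
τ_F = 0`, and the two equations of the theorem are these two conditions.

For `ω`, the Leibniz rule along `F` gives `∇(F^*ω)(u, v) = (∇ω)(F_* u, F_* v) + ω(β_F(u, v))`, and
the trace yields the first equation (`dStar_pullback`).

For `π`, the composition formula `β_{π∘F} = π_* β_F + β_π(F_*, F_*)` leaves only the diagonal values
of `β_π` to be found (`secondFundamentalForm_proj_self`). Since both connections are torsion-free,
`β_π` is symmetric, so `β_π(u, u)` splits into `β_π(hu, hu) + 2 β_π(hu, vu) + β_π(vu, vu)`. The
first term vanishes by projectability. In the others `π_*` kills the vertical field, so `β_π(w, vu)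
= -π_* ∇_w (vU)`; with `w = hu` and `w = vu` this is `-π_* A_u u` and `-π_* T_u u`.

Both formulas rest on one Leibniz rule, `mvfderiv_form_apply`, applied once to `ω` and once to the
differential of a map read as a vector-valued 1-form in coordinates of the target. -/

noncomputable section

namespace PrincipalHarmonic

/-! ### Differential calculus of vector-valued functions on a manifold -/

section VectorValued

variable {E : Type*} [NormedAddCommGroup E] [NormedSpace ℝ E]
  {N : Type*} [TopologicalSpace N] [ChartedSpace E N]
  {V : Type*} [NormedAddCommGroup V] [NormedSpace ℝ V]
  {W : Type*} [NormedAddCommGroup W] [NormedSpace ℝ W]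

lemma mvfderiv_congr {f g : N → W} {x : N} (h : f =ᶠ[nhds x] g) :
    mvfderiv 𝓘(ℝ, E) f x = mvfderiv 𝓘(ℝ, E) g x := by
  ext u
  have := h.mfderiv_eq (I := 𝓘(ℝ, E)) (I' := 𝓘(ℝ, W))
  exact congrArg (fun A : E →L[ℝ] W ↦ A u) this

/-- The bridge to calculus in normed spaces: product and chain rules are proved for the chart
expression and carried back, with values in `W` itself rather than in its tangent spaces. -/
lemma mvfderiv_eq_of_hasFDerivWithinAt {f : N → W} {x : N} {f' : E →L[ℝ] W}
    (hc : ContinuousAt f x)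
    (hf : HasFDerivWithinAt (writtenInExtChartAt 𝓘(ℝ, E) 𝓘(ℝ, W) x f) f'
      (Set.range 𝓘(ℝ, E)) (extChartAt 𝓘(ℝ, E) x x)) (u : TangentSpace 𝓘(ℝ, E) x) :
    mvfderiv 𝓘(ℝ, E) f x u = f' u := by
  have : HasMFDerivAt 𝓘(ℝ, E) 𝓘(ℝ, W) f x f' := ⟨hc, hf⟩
  exact congrArg (fun A : E →L[ℝ] W ↦ A u) this.mfderiv

lemma hasFDerivWithinAt_mvfderiv {f : N → W} {x : N}
    (hf : MDifferentiableAt 𝓘(ℝ, E) 𝓘(ℝ, W) f x) :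
    HasFDerivWithinAt (writtenInExtChartAt 𝓘(ℝ, E) 𝓘(ℝ, W) x f) (mvfderiv 𝓘(ℝ, E) f x : E →L[ℝ] W)
      (Set.range 𝓘(ℝ, E)) (extChartAt 𝓘(ℝ, E) x x) :=
  hf.hasMFDerivAt.2

lemma writtenInExtChartAt_self (f : N → W) (x : N) :
    writtenInExtChartAt 𝓘(ℝ, E) 𝓘(ℝ, W) x f (extChartAt 𝓘(ℝ, E) x x) = f x := by
  simp only [writtenInExtChartAt, Function.comp_apply, extChartAt_to_inv]
  rfl

lemma mvfderiv_comp_fderiv {g : V → W} {f : N → V} {x : N} {g' : V →L[ℝ] W}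
    (hg : HasFDerivAt g g' (f x)) (hf : MDifferentiableAt 𝓘(ℝ, E) 𝓘(ℝ, V) f x)
    (u : TangentSpace 𝓘(ℝ, E) x) :
    mvfderiv 𝓘(ℝ, E) (fun y ↦ g (f y)) x u = g' (mvfderiv 𝓘(ℝ, E) f x u) := by
  have hc : ContinuousAt (fun y ↦ g (f y)) x := hg.continuousAt.comp hf.continuousAt
  let f' : E →L[ℝ] V := mvfderiv 𝓘(ℝ, E) f x
  have h : HasFDerivWithinAt (writtenInExtChartAt 𝓘(ℝ, E) 𝓘(ℝ, V) x f) f'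
      (Set.range 𝓘(ℝ, E)) (extChartAt 𝓘(ℝ, E) x x) := hasFDerivWithinAt_mvfderiv hf
  have hg' : HasFDerivAt g g'
      (writtenInExtChartAt 𝓘(ℝ, E) 𝓘(ℝ, V) x f (extChartAt 𝓘(ℝ, E) x x)) := by
    rwa [writtenInExtChartAt_self]
  exact mvfderiv_eq_of_hasFDerivWithinAt (f' := g'.comp f') hc
    (hg'.comp_hasFDerivWithinAt _ h) u

lemma mvfderiv_clm_comp (L : V →L[ℝ] W) {f : N → V} {x : N}
    (hf : MDifferentiableAt 𝓘(ℝ, E) 𝓘(ℝ, V) f x) (u : TangentSpace 𝓘(ℝ, E) x) :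
    mvfderiv 𝓘(ℝ, E) (fun y ↦ L (f y)) x u = L (mvfderiv 𝓘(ℝ, E) f x u) :=
  mvfderiv_comp_fderiv L.hasFDerivAt hf u

lemma mvfderiv_clm_apply {A : N → V →L[ℝ] W} {c : N → V} {x : N}
    (hA : MDifferentiableAt 𝓘(ℝ, E) 𝓘(ℝ, V →L[ℝ] W) A x)
    (hc : MDifferentiableAt 𝓘(ℝ, E) 𝓘(ℝ, V) c x) (u : TangentSpace 𝓘(ℝ, E) x) :
    mvfderiv 𝓘(ℝ, E) (fun y ↦ A y (c y)) x u
      = mvfderiv 𝓘(ℝ, E) A x u (c x) + A x (mvfderiv 𝓘(ℝ, E) c x u) := by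
  have h := (hasFDerivWithinAt_mvfderiv hA).clm_apply (hasFDerivWithinAt_mvfderiv hc)
  rw [writtenInExtChartAt_self, writtenInExtChartAt_self] at h
  refine (mvfderiv_eq_of_hasFDerivWithinAt (hA.clm_apply hc).continuousAt h u).trans ?_
  exact add_comm _ _

variable [FiniteDimensional ℝ V]

/-- In finite dimension an operator is a finite sum of rank-one operators built from its values on a
basis, so testing on vectors suffices. -/
lemma mdifferentiableAt_clm_of_apply {A : N → V →L[ℝ] W} {x : N}
    (h : ∀ v, MDifferentiableAt 𝓘(ℝ, E) 𝓘(ℝ, W) (fun y ↦ A y v) x) :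
    MDifferentiableAt 𝓘(ℝ, E) 𝓘(ℝ, V →L[ℝ] W) A x := by
  let b := Module.finBasis ℝ V
  have hA : A = fun y ↦ ∑ i, (ContinuousLinearMap.smulRightL ℝ V W
      (LinearMap.toContinuousLinearMap (b.coord i))) (A y (b i)) := by
    funext y
    ext v
    conv_lhs => rw [← b.sum_repr v, map_sum]
    simp
  rw [hA]
  have key : ∀ s : Finset (Fin (Module.finrank ℝ V)),
      MDifferentiableAt 𝓘(ℝ, E) 𝓘(ℝ, V →L[ℝ] W) (fun y ↦ ∑ i ∈ s,
        (ContinuousLinearMap.smulRightL ℝ V W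
        (LinearMap.toContinuousLinearMap (b.coord i))) (A y (b i))) x := by
    intro s
    induction s using Finset.cons_induction with
    | empty => simpa using mdifferentiableAt_const
    | cons i s hi ih =>
      simp only [Finset.sum_cons]
      exact (((ContinuousLinearMap.smulRightL ℝ V W
        (LinearMap.toContinuousLinearMap
          (b.coord i))).differentiableAt.comp_mdifferentiableAt (h (b i)))).add ih
  exact key _

end VectorValued

/-! ### Coordinates of tangent vectors in a local trivialization -/

section Frames

variable {E : Type*} [NormedAddCommGroup E] [NormedSpace ℝ E]
  {N : Type*} [TopologicalSpace N] [ChartedSpace E N]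
  {E' : Type*} [NormedAddCommGroup E'] [NormedSpace ℝ E']
  {P : Type*} [TopologicalSpace P] [ChartedSpace E' P] [IsManifold 𝓘(ℝ, E') ∞ P]
  {W : Type*} [NormedAddCommGroup W] [NormedSpace ℝ W]

/-- Coordinates of a tangent vector at `p` in the trivialization of the tangent bundle at `q`. -/
def tangentCoord (q p : P) : TangentSpace 𝓘(ℝ, E') p →L[ℝ] E' :=
  (trivializationAt E' (TangentSpace 𝓘(ℝ, E') : P → Type _) q).continuousLinearMapAt ℝ p

/-- The tangent vector at `p` with given coordinates in the trivialization of the tangent bundle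
at `q`. -/
def tangentFrame (q p : P) : E' →L[ℝ] TangentSpace 𝓘(ℝ, E') p :=
  (trivializationAt E' (TangentSpace 𝓘(ℝ, E') : P → Type _) q).symmL ℝ p

lemma mem_baseSet_iff {q p : P} :
    p ∈ (trivializationAt E' (TangentSpace 𝓘(ℝ, E') : P → Type _) q).baseSet ↔
      p ∈ (chartAt E' q).source := by
  simp

omit [NormedSpace ℝ E'] [IsManifold 𝓘(ℝ, E') ∞ P] in
lemma chart_source_mem_nhds (q : P) : (chartAt E' q).source ∈ nhds q :=
  (chartAt E' q).open_source.mem_nhds (mem_chart_source _ _)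

lemma tangentCoord_eq {q p : P} (hp : p ∈ (chartAt E' q).source) (w : TangentSpace 𝓘(ℝ, E') p) :
    tangentCoord q p w = (trivializationAt E' (TangentSpace 𝓘(ℝ, E') : P → Type _) q ⟨p, w⟩).2 :=
  Trivialization.continuousLinearMapAt_apply_of_mem ℝ _ (mem_baseSet_iff.2 hp) w

lemma tangentFrame_eq {q p : P} (hp : p ∈ (chartAt E' q).source) (e : E') :
    tangentFrame q p e = (trivializationAt E' (TangentSpace 𝓘(ℝ, E') : P → Type _) q).symm p e :=
  Trivialization.symmL_apply _ (mem_baseSet_iff.2 hp) e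

lemma tangentFrame_tangentCoord {q p : P} (hp : p ∈ (chartAt E' q).source)
    (w : TangentSpace 𝓘(ℝ, E') p) : tangentFrame q p (tangentCoord q p w) = w :=
  Trivialization.symmL_continuousLinearMapAt _ (mem_baseSet_iff.2 hp) w

lemma tangentCoord_tangentFrame {q p : P} (hp : p ∈ (chartAt E' q).source) (e : E') :
    tangentCoord q p (tangentFrame (E' := E') q p e) = e :=
  Trivialization.continuousLinearMapAt_symmL _ (mem_baseSet_iff.2 hp) e

/-- `FiberBundle.extend` has constant coordinates on the chart domain. The definitions of the
pullback connection and of `β` use this extension, and the constancy is what removes derivative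
terms below. -/
lemma extend_eq_tangentFrame {q p : P} (hp : p ∈ (chartAt E' q).source)
    (w : TangentSpace 𝓘(ℝ, E') q) :
    FiberBundle.extend E' w p = tangentFrame q p (tangentCoord q q w) := by
  rw [tangentFrame_eq hp, tangentCoord_eq (mem_chart_source _ _)]
  rfl

lemma mdifferentiableAt_along_iff {F : N → P} {Z : Π y : N, TangentSpace 𝓘(ℝ, E') (F y)} {x : N}
    (hF : MDifferentiableAt 𝓘(ℝ, E) 𝓘(ℝ, E') F x) :
    MDifferentiableAt 𝓘(ℝ, E) (𝓘(ℝ, E').prod 𝓘(ℝ, E'))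
      (fun y ↦ (⟨F y, Z y⟩ : TangentBundle 𝓘(ℝ, E') P)) x ↔
    MDifferentiableAt 𝓘(ℝ, E) 𝓘(ℝ, E') (fun y ↦ tangentCoord (F x) (F y) (Z y)) x := by
  rw [mdifferentiableAt_totalSpace]
  refine (and_iff_right hF).trans (Filter.EventuallyEq.mdifferentiableAt_iff ?_)
  filter_upwards [hF.continuousAt.preimage_mem_nhds (chart_source_mem_nhds (E' := E') (F x))] with y hy
  exact (tangentCoord_eq hy _).symm

lemma mdifferentiableAt_section_iff_tangentCoord {X : Π p : P, TangentSpace 𝓘(ℝ, E') p} {q : P} :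
    MDiffAt (T% X) q ↔
      MDifferentiableAt 𝓘(ℝ, E') 𝓘(ℝ, E') (fun p ↦ tangentCoord q p (X p)) q :=
  mdifferentiableAt_along_iff (F := fun p : P ↦ p) mdifferentiableAt_id

end Frames

/-! ### The pullback connection and its Leibniz rule -/

section Pullback

variable {E : Type*} [NormedAddCommGroup E] [NormedSpace ℝ E]
  {N : Type*} [TopologicalSpace N] [ChartedSpace E N]
  {E' : Type*} [NormedAddCommGroup E'] [NormedSpace ℝ E']
  {P : Type*} [TopologicalSpace P] [ChartedSpace E' P] [IsManifold 𝓘(ℝ, E') ∞ P]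
  {W : Type*} [NormedAddCommGroup W] [NormedSpace ℝ W]
  (cov : CovariantDerivative 𝓘(ℝ, E') E' (TangentSpace 𝓘(ℝ, E') : P → Type _))

omit [IsManifold 𝓘(ℝ, E') ∞ P] in
lemma mvfderiv_comp_mfderiv {F : N → P} {f : P → W} {x : N}
    (hf : MDifferentiableAt 𝓘(ℝ, E') 𝓘(ℝ, W) f (F x))
    (hF : MDifferentiableAt 𝓘(ℝ, E) 𝓘(ℝ, E') F x) (u : TangentSpace 𝓘(ℝ, E) x) :
    mvfderiv 𝓘(ℝ, E) (fun y ↦ f (F y)) x u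
      = mvfderiv 𝓘(ℝ, E') f (F x) (mfderiv 𝓘(ℝ, E) 𝓘(ℝ, E') F x u) := by
  have h := mfderiv_comp x hf hF
  exact congrArg (fun A : E →L[ℝ] W ↦ A u) h

lemma mdifferentiableAt_extend (q : P) (w : TangentSpace 𝓘(ℝ, E') q) :
    MDiffAt (T% (FiberBundle.extend E' w)) q :=
  FiberBundle.mdifferentiableAt_extend 𝓘(ℝ, E') E' w

lemma mdifferentiableAt_tangentFrame (q : P) (e : E') :
    MDiffAt (T% (fun p ↦ tangentFrame (E' := E') q p e)) q := by
  rw [mdifferentiableAt_section_iff_tangentCoord]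
  refine (mdifferentiableAt_const (c := e)).congr_of_eventuallyEq ?_
  filter_upwards [chart_source_mem_nhds (E' := E') q] with p hp
  exact tangentCoord_tangentFrame hp e

lemma cov_congr {X Y : Π p : P, TangentSpace 𝓘(ℝ, E') p} {q : P} (hX : MDiffAt (T% X) q)
    (hY : MDiffAt (T% Y) q) (h : ∀ᶠ p in nhds q, X p = Y p) : cov X q = cov Y q :=
  cov.isCovariantDerivativeOnUniv.congr_of_eventuallyEq hX hY Filter.univ_mem h

lemma cov_sum_smul {ι : Type*} (s : Finset ι) (f : ι → P → ℝ)
    (X : ι → Π p : P, TangentSpace 𝓘(ℝ, E') p) {q : P}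
    (hf : ∀ i, MDiffAt (f i) q) (hX : ∀ i, MDiffAt (T% (X i)) q) :
    cov (∑ i ∈ s, f i • X i) q
      = ∑ i ∈ s, (f i q • cov (X i) q + (mvfderiv 𝓘(ℝ, E') (f i) q).smulRight (X i q)) := by
  induction s using Finset.cons_induction with
  | empty => simp
  | cons i s hi ih =>
    have hs : MDiffAt (T% (∑ i ∈ s, f i • X i)) q := by
      have := MDifferentiableAt.sum_section (I := 𝓘(ℝ, E')) (F := E') (s := s)
        (t := fun i ↦ f i • X i) (x₀ := q) (fun i _ ↦ (hf i).smul_section (hX i))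
      convert this using 3
      simp
    rw [Finset.sum_cons, Finset.sum_cons,
      cov.isCovariantDerivativeOnUniv.add ((hf i).smul_section (hX i)) hs, ih,
      cov.isCovariantDerivativeOnUniv.leibniz (hX i) (hf i)]

variable [FiniteDimensional ℝ E']

/-- A covariant derivative splits into the derivative of the coordinates and the covariant
derivative of the extension with constant coordinates. -/
lemma cov_eq_tangentFrame_add {X : Π p : P, TangentSpace 𝓘(ℝ, E') p} {q : P}
    (hX : MDiffAt (T% X) q) (u : TangentSpace 𝓘(ℝ, E') q) :
    cov X q u
      = tangentFrame q q (mvfderiv 𝓘(ℝ, E') (fun p ↦ tangentCoord q p (X p)) q u)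
        + cov (FiberBundle.extend E' (X q)) q u := by
  let b := Module.finBasis ℝ E'
  let c : P → E' := fun p ↦ tangentCoord q p (X p)
  have hc : MDifferentiableAt 𝓘(ℝ, E') 𝓘(ℝ, E') c q :=
    mdifferentiableAt_section_iff_tangentCoord.1 hX
  let L : Fin (Module.finrank ℝ E') → E' →L[ℝ] ℝ :=
    fun i ↦ LinearMap.toContinuousLinearMap (b.coord i)
  have hL : ∀ e : E', ∑ i, L i e • b i = e := fun e ↦ b.sum_repr e
  have hf : ∀ i, MDiffAt (fun p ↦ L i (c p)) q :=
    fun i ↦ (L i).differentiableAt.comp_mdifferentiableAt hc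
  have hconst : ∀ i, MDiffAt (fun _ : P ↦ L i (c q)) q := fun i ↦ mdifferentiableAt_const
  have hb : ∀ i, MDiffAt (T% (fun p ↦ tangentFrame (E' := E') q p (b i))) q :=
    fun i ↦ mdifferentiableAt_tangentFrame q _
  have hsum : ∀ f : Fin (Module.finrank ℝ E') → P → ℝ, (∀ i, MDiffAt (f i) q) →
      MDiffAt (T% (∑ i, f i • fun p ↦ tangentFrame (E' := E') q p (b i))) q := by
    intro f hf
    have := MDifferentiableAt.sum_section (I := 𝓘(ℝ, E')) (F := E') (s := Finset.univ)
        (t := fun i ↦ f i • fun p ↦ tangentFrame (E' := E') q p (b i)) (x₀ := q)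
        (fun i _ ↦ (hf i).smul_section (hb i))
    convert this using 3
    simp
  have h1 : cov X q = cov (∑ i, (fun p ↦ L i (c p)) • fun p ↦ tangentFrame q p (b i)) q := by
    refine cov_congr cov hX (hsum _ hf) ?_
    filter_upwards [chart_source_mem_nhds (E' := E') q] with p hp
    rw [← tangentFrame_tangentCoord hp (X p)]
    conv_lhs => rw [← hL (tangentCoord q p (X p)), map_sum]
    simp [c]
  have h2 : cov (FiberBundle.extend E' (X q)) q
      = cov (∑ i, (fun _ : P ↦ L i (c q)) • fun p ↦ tangentFrame q p (b i)) q := by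
    refine cov_congr cov (mdifferentiableAt_extend q _) (hsum _ hconst) ?_
    filter_upwards [chart_source_mem_nhds (E' := E') q] with p hp
    rw [extend_eq_tangentFrame hp]
    conv_lhs => rw [← hL (tangentCoord q q (X q)), map_sum]
    simp [c]
  -- The two expansions have the same coefficients at `q`, so the derivatives of the frame fields
  -- cancel. Constant coefficients have zero derivative, and the remaining terms are the coordinates
  -- of the derivative of `c`.
  rw [h1, h2, cov_sum_smul cov Finset.univ _ _ hf hb, cov_sum_smul cov Finset.univ _ _ hconst hb]
  have h3 : mvfderiv 𝓘(ℝ, E') c q u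
      = ∑ i, mvfderiv 𝓘(ℝ, E') (fun p ↦ L i (c p)) q u • b i := by
    rw [← hL (mvfderiv 𝓘(ℝ, E') c q u)]
    simp only [mvfderiv_clm_comp _ hc]
  rw [show (fun p ↦ tangentCoord q p (X p)) = c from rfl, h3]
  simp [Finset.sum_add_distrib, mvfderiv_const]
  abel

omit [FiniteDimensional ℝ E'] in
lemma pullbackCov_eq {F : N → P} {V : Π y : N, TangentSpace 𝓘(ℝ, E') (F y)} {x : N}
    (hF : ContinuousAt F x) (u : TangentSpace 𝓘(ℝ, E) x) :
    pullbackCov cov F V x u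
      = tangentFrame (F x) (F x)
          (mvfderiv 𝓘(ℝ, E) (fun y ↦ tangentCoord (F x) (F y) (V y)) x u)
        + cov (FiberBundle.extend E' (V x)) (F x) (mfderiv 𝓘(ℝ, E) 𝓘(ℝ, E') F x u) := by
  have : (fun y ↦ (trivializationAt E' (TangentSpace 𝓘(ℝ, E') : P → Type _) (F x)
      ⟨F y, V y⟩).2) =ᶠ[nhds x] (fun y ↦ tangentCoord (F x) (F y) (V y)) := by
    filter_upwards [hF.preimage_mem_nhds (chart_source_mem_nhds (E' := E') (F x))] with y hy
    exact (tangentCoord_eq hy _).symm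
  simp only [pullbackCov, mvfderiv_congr this]
  rw [tangentFrame_eq (mem_chart_source _ _)]

/-- Both sides split into a coordinate derivative and a connection term. The connection terms
coincide, and the coordinate derivatives agree by the chain rule. -/
lemma pullbackCov_comp {F : N → P} {X : Π p : P, TangentSpace 𝓘(ℝ, E') p} {x : N}
    (hF : MDifferentiableAt 𝓘(ℝ, E) 𝓘(ℝ, E') F x) (hX : MDiffAt (T% X) (F x))
    (u : TangentSpace 𝓘(ℝ, E) x) :
    pullbackCov cov F (fun y ↦ X (F y)) x u = cov X (F x) (mfderiv 𝓘(ℝ, E) 𝓘(ℝ, E') F x u) := by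
  rw [pullbackCov_eq cov hF.continuousAt, cov_eq_tangentFrame_add cov hX]
  have hc := mdifferentiableAt_section_iff_tangentCoord.1 hX
  rw [← mvfderiv_comp_mfderiv hc hF]

omit [FiniteDimensional ℝ E'] in
/-- The Leibniz rule for the contraction of a 1-form with a vector field along a map. -/
lemma mvfderiv_form_apply {F : N → P} {V : Π y : N, TangentSpace 𝓘(ℝ, E') (F y)} {x : N}
    {α : Π p : P, TangentSpace 𝓘(ℝ, E') p →L[ℝ] W}
    (hF : MDifferentiableAt 𝓘(ℝ, E) 𝓘(ℝ, E') F x)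
    (hV : MDifferentiableAt 𝓘(ℝ, E) 𝓘(ℝ, E') (fun y ↦ tangentCoord (F x) (F y) (V y)) x)
    (hα : MDifferentiableAt 𝓘(ℝ, E') 𝓘(ℝ, E' →L[ℝ] W)
      (fun p ↦ (α p).comp (tangentFrame (F x) p)) (F x))
    (u : TangentSpace 𝓘(ℝ, E) x) :
    mvfderiv 𝓘(ℝ, E) (fun y ↦ α (F y) (V y)) x u
      = covDerivForm cov α (F x) (mfderiv 𝓘(ℝ, E) 𝓘(ℝ, E') F x u) (V x)
        + α (F x) (pullbackCov cov F V x u) := by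
  have h1 : (fun y ↦ α (F y) (V y)) =ᶠ[nhds x] fun y ↦
      ((α (F y)).comp (tangentFrame (F x) (F y))) (tangentCoord (F x) (F y) (V y)) := by
    filter_upwards [hF.continuousAt.preimage_mem_nhds
      (chart_source_mem_nhds (E' := E') (F x))] with y hy
    simp [tangentFrame_tangentCoord hy]
  have h2 : (fun p ↦ α p (FiberBundle.extend E' (V x) p)) =ᶠ[nhds (F x)] fun p ↦
      ((α p).comp (tangentFrame (F x) p)) (tangentCoord (F x) (F x) (V x)) := by
    filter_upwards [chart_source_mem_nhds (E' := E') (F x)] with p hp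
    simp [extend_eq_tangentFrame hp]
  have hαF : MDifferentiableAt 𝓘(ℝ, E) 𝓘(ℝ, E' →L[ℝ] W)
      (fun y ↦ (α (F y)).comp (tangentFrame (F x) (F y))) x := hα.comp x hF
  -- In the frame, `α(V)` is a matrix applied to coordinates. The derivative of the matrix is the
  -- same for `V` and for its constant-coordinate extension, so it is absorbed by `∇α`; the
  -- derivative of the coordinates belongs to the pullback connection.
  rw [mvfderiv_congr h1, mvfderiv_clm_apply hαF hV, covDerivForm, mvfderiv_congr h2,
    mvfderiv_clm_apply hα mdifferentiableAt_const, pullbackCov_eq cov hF.continuousAt, map_add,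
    mvfderiv_const]
  rw [← mvfderiv_comp_mfderiv hα hF]
  simp only [zero_apply, map_zero, ContinuousLinearMap.comp_apply]
  abel

end Pullback

/-! ### Second fundamental forms and the composition formula -/

section SecondFundamentalForm

variable {E : Type*} [NormedAddCommGroup E] [NormedSpace ℝ E]
  {N : Type*} [TopologicalSpace N] [ChartedSpace E N]
  {E' : Type*} [NormedAddCommGroup E'] [NormedSpace ℝ E'] [FiniteDimensional ℝ E']
  {P : Type*} [TopologicalSpace P] [ChartedSpace E' P] [IsManifold 𝓘(ℝ, E') ∞ P]
  {E'' : Type*} [NormedAddCommGroup E''] [NormedSpace ℝ E'']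
  {M : Type*} [TopologicalSpace M] [ChartedSpace E'' M] [IsManifold 𝓘(ℝ, E'') ∞ M]
  {W : Type*} [NormedAddCommGroup W] [NormedSpace ℝ W]

omit [FiniteDimensional ℝ E'] in
-- The field `F_* X` along `F` is the section `X` followed by the tangent map of `F`, which is of
-- class `C^1`.
lemma mdifferentiableAt_pushforward [IsManifold 𝓘(ℝ, E) ∞ N] {F : N → P} (hF : ContMDiff 𝓘(ℝ, E) 𝓘(ℝ, E') ∞ F)
    {X : Π y : N, TangentSpace 𝓘(ℝ, E) y} {x : N} (hX : MDiffAt (T% X) x) :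
    MDifferentiableAt 𝓘(ℝ, E) 𝓘(ℝ, E')
      (fun y ↦ tangentCoord (F x) (F y) (mfderiv 𝓘(ℝ, E) 𝓘(ℝ, E') F y (X y))) x := by
  rw [← mdifferentiableAt_along_iff (hF.mdifferentiable (by simp) x)]
  have h1 : ContMDiff 𝓘(ℝ, E).tangent 𝓘(ℝ, E').tangent 1 (tangentMap 𝓘(ℝ, E) 𝓘(ℝ, E') F) :=
    hF.contMDiff_tangentMap (by decide)
  exact (h1.mdifferentiable (by simp) _).comp x hX

lemma mdifferentiableAt_form_comp_tangentFrame
    {α : Π p : P, TangentSpace 𝓘(ℝ, E') p →L[ℝ] W} {q : P}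
    (hα : ∀ X : Π p : P, TangentSpace 𝓘(ℝ, E') p, MDiffAt (T% X) q →
      MDifferentiableAt 𝓘(ℝ, E') 𝓘(ℝ, W) (fun p ↦ α p (X p)) q) :
    MDifferentiableAt 𝓘(ℝ, E') 𝓘(ℝ, E' →L[ℝ] W) (fun p ↦ (α p).comp (tangentFrame q p)) q :=
  mdifferentiableAt_clm_of_apply fun e ↦ hα _ (mdifferentiableAt_tangentFrame q e)

/-- The differential of `G` near `q` as a 1-form, in the trivialization at `G q`. -/
def differentialForm (G : P → M) (q p : P) : TangentSpace 𝓘(ℝ, E') p →L[ℝ] E'' :=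
  (tangentCoord (G q) (G p)).comp (mfderiv 𝓘(ℝ, E') 𝓘(ℝ, E'') G p)

lemma mdifferentiableAt_differentialForm {G : P → M} (hG : ContMDiff 𝓘(ℝ, E') 𝓘(ℝ, E'') ∞ G)
    (q : P) : MDifferentiableAt 𝓘(ℝ, E') 𝓘(ℝ, E' →L[ℝ] E'')
      (fun p ↦ (differentialForm (E' := E') (E'' := E'') G q p).comp (tangentFrame (E' := E') q p)) q :=
  mdifferentiableAt_form_comp_tangentFrame (α := differentialForm G q)
    fun _ hX ↦ mdifferentiableAt_pushforward hG hX

omit [FiniteDimensional ℝ E'] [IsManifold 𝓘(ℝ, E') ∞ P] in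
lemma tangentFrame_differentialForm (G : P → M) (q : P) (w : TangentSpace 𝓘(ℝ, E') q) :
    tangentFrame (G q) (G q) (differentialForm G q q w) = mfderiv 𝓘(ℝ, E') 𝓘(ℝ, E'') G q w :=
  tangentFrame_tangentCoord (mem_chart_source _ _) _

omit [FiniteDimensional ℝ E'] in
-- In coordinates at `G q`, `β_G` is the covariant derivative of a 1-form plus a connection term of
-- the target. This form makes the Leibniz rule for 1-forms available for maps.
lemma secondFundamentalForm_eq (covP : CovariantDerivative 𝓘(ℝ, E') E' (TangentSpace 𝓘(ℝ, E') : P → Type _))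
    (covM : CovariantDerivative 𝓘(ℝ, E'') E'' (TangentSpace 𝓘(ℝ, E'') : M → Type _))
    {G : P → M} {q : P} (hG : ContinuousAt G q) (u v : TangentSpace 𝓘(ℝ, E') q) :
    secondFundamentalForm covP covM G q u v
      = tangentFrame (G q) (G q) (covDerivForm covP (differentialForm G q) q u v)
        + covM (FiberBundle.extend E'' (mfderiv 𝓘(ℝ, E') 𝓘(ℝ, E'') G q v)) (G q)
          (mfderiv 𝓘(ℝ, E') 𝓘(ℝ, E'') G q u) := by
  rw [secondFundamentalForm, pullbackCov_eq covM hG, covDerivForm, map_sub,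
    tangentFrame_differentialForm, FiberBundle.extend_apply_self]
  simp only [differentialForm, ContinuousLinearMap.comp_apply]
  abel

/-- This is the Leibniz rule for the pairing of the differential of `G` with `V`; the connection
term of the target is the same on both sides. -/
lemma pullbackCov_pushforward
    (covP : CovariantDerivative 𝓘(ℝ, E') E' (TangentSpace 𝓘(ℝ, E') : P → Type _))
    (covM : CovariantDerivative 𝓘(ℝ, E'') E'' (TangentSpace 𝓘(ℝ, E'') : M → Type _))
    {F : N → P} {V : Π y : N, TangentSpace 𝓘(ℝ, E') (F y)} {x : N}
    {G : P → M} (hG : ContMDiff 𝓘(ℝ, E') 𝓘(ℝ, E'') ∞ G)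
    (hF : MDifferentiableAt 𝓘(ℝ, E) 𝓘(ℝ, E') F x)
    (hV : MDifferentiableAt 𝓘(ℝ, E) 𝓘(ℝ, E') (fun y ↦ tangentCoord (F x) (F y) (V y)) x)
    (u : TangentSpace 𝓘(ℝ, E) x) :
    pullbackCov covM (fun y ↦ G (F y)) (fun y ↦ mfderiv 𝓘(ℝ, E') 𝓘(ℝ, E'') G (F y) (V y)) x u
      = mfderiv 𝓘(ℝ, E') 𝓘(ℝ, E'') G (F x) (pullbackCov covP F V x u)
        + secondFundamentalForm covP covM G (F x) (mfderiv 𝓘(ℝ, E) 𝓘(ℝ, E') F x u) (V x) := by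
  have hGd := hG.mdifferentiable (by simp) (F x)
  have hGF : MDifferentiableAt 𝓘(ℝ, E) 𝓘(ℝ, E'') (fun y ↦ G (F y)) x := hGd.comp x hF
  have hd : mfderiv 𝓘(ℝ, E) 𝓘(ℝ, E'') (fun y ↦ G (F y)) x u
      = mfderiv 𝓘(ℝ, E') 𝓘(ℝ, E'') G (F x) (mfderiv 𝓘(ℝ, E) 𝓘(ℝ, E') F x u) := by
    have := mfderiv_comp x hGd hF
    exact congrArg (fun A : E →L[ℝ] E'' ↦ A u) this
  have h := mvfderiv_form_apply covP hF hV (mdifferentiableAt_differentialForm hG (F x)) u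
  rw [pullbackCov_eq covM hGF.continuousAt, secondFundamentalForm_eq _ _ hGd.continuousAt, hd]
  have h' : mvfderiv 𝓘(ℝ, E) (fun y ↦ tangentCoord (G (F x)) (G (F y))
      (mfderiv 𝓘(ℝ, E') 𝓘(ℝ, E'') G (F y) (V y))) x u = _ := h
  rw [h', map_add, tangentFrame_differentialForm]
  abel

/-- The second fundamental form of a composition. -/
lemma secondFundamentalForm_comp [IsManifold 𝓘(ℝ, E) ∞ N]
    (covN : CovariantDerivative 𝓘(ℝ, E) E (TangentSpace 𝓘(ℝ, E) : N → Type _))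
    (covP : CovariantDerivative 𝓘(ℝ, E') E' (TangentSpace 𝓘(ℝ, E') : P → Type _))
    (covM : CovariantDerivative 𝓘(ℝ, E'') E'' (TangentSpace 𝓘(ℝ, E'') : M → Type _))
    {F : N → P} (hF : ContMDiff 𝓘(ℝ, E) 𝓘(ℝ, E') ∞ F)
    {G : P → M} (hG : ContMDiff 𝓘(ℝ, E') 𝓘(ℝ, E'') ∞ G) (x : N) (u v : TangentSpace 𝓘(ℝ, E) x) :
    secondFundamentalForm covN covM (G ∘ F) x u v
      = mfderiv 𝓘(ℝ, E') 𝓘(ℝ, E'') G (F x) (secondFundamentalForm covN covP F x u v)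
        + secondFundamentalForm covP covM G (F x) (mfderiv 𝓘(ℝ, E) 𝓘(ℝ, E') F x u)
          (mfderiv 𝓘(ℝ, E) 𝓘(ℝ, E') F x v) := by
  have hd : ∀ y (w : TangentSpace 𝓘(ℝ, E) y), mfderiv 𝓘(ℝ, E) 𝓘(ℝ, E'') (G ∘ F) y w
      = mfderiv 𝓘(ℝ, E') 𝓘(ℝ, E'') G (F y) (mfderiv 𝓘(ℝ, E) 𝓘(ℝ, E') F y w) := by
    intro y w
    have := mfderiv_comp y (hG.mdifferentiable (by simp) (F y)) (hF.mdifferentiable (by simp) y)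
    exact congrArg (fun A : E →L[ℝ] E'' ↦ A w) this
  have h := pullbackCov_pushforward covP covM hG (hF.mdifferentiable (by simp) x)
    (mdifferentiableAt_pushforward hF (mdifferentiableAt_extend x v)) u
  rw [FiberBundle.extend_apply_self] at h
  have h1 : secondFundamentalForm covN covM (G ∘ F) x u v
      = pullbackCov covM (fun y ↦ G (F y)) (fun y ↦ mfderiv 𝓘(ℝ, E') 𝓘(ℝ, E'') G (F y)
          (mfderiv 𝓘(ℝ, E) 𝓘(ℝ, E') F y (FiberBundle.extend E v y))) x u
        - mfderiv 𝓘(ℝ, E') 𝓘(ℝ, E'') G (F x)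
          (mfderiv 𝓘(ℝ, E) 𝓘(ℝ, E') F x (covN (FiberBundle.extend E v) x u)) := by
    simp only [secondFundamentalForm, hd]
    rfl
  have h2 : secondFundamentalForm covN covP F x u v
      = pullbackCov covP F (fun y ↦ mfderiv 𝓘(ℝ, E) 𝓘(ℝ, E') F y (FiberBundle.extend E v y)) x u
        - mfderiv 𝓘(ℝ, E) 𝓘(ℝ, E') F x (covN (FiberBundle.extend E v) x u) := rfl
  rw [h1, h, h2, map_sub]
  abel

/-- The second fundamental form may be computed with any vector field. -/
lemma secondFundamentalForm_eq_pullbackCov_sub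
    (covP : CovariantDerivative 𝓘(ℝ, E') E' (TangentSpace 𝓘(ℝ, E') : P → Type _))
    (covM : CovariantDerivative 𝓘(ℝ, E'') E'' (TangentSpace 𝓘(ℝ, E'') : M → Type _))
    {G : P → M} (hG : ContMDiff 𝓘(ℝ, E') 𝓘(ℝ, E'') ∞ G)
    {X : Π p : P, TangentSpace 𝓘(ℝ, E') p} {q : P} (hX : MDiffAt (T% X) q)
    (u : TangentSpace 𝓘(ℝ, E') q) :
    secondFundamentalForm covP covM G q u (X q)
      = pullbackCov covM G (fun p ↦ mfderiv 𝓘(ℝ, E') 𝓘(ℝ, E'') G p (X p)) q u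
        - mfderiv 𝓘(ℝ, E') 𝓘(ℝ, E'') G q (covP X q u) := by
  -- With `F` the identity, the pullback connection is the connection itself, and independence of
  -- the chosen field follows.
  have h := pullbackCov_pushforward covP covM hG (F := fun p : P ↦ p) (V := X) (x := q)
    mdifferentiableAt_id (mdifferentiableAt_section_iff_tangentCoord.1 hX) u
  have h2 := pullbackCov_comp covP (F := fun p : P ↦ p) (x := q) mdifferentiableAt_id hX u
  have h3 : mfderiv 𝓘(ℝ, E') 𝓘(ℝ, E') (fun p : P ↦ p) q u = u := by
    rw [show (fun p : P ↦ p) = id from rfl, mfderiv_id]; rfl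
  rw [h2, h3] at h
  rw [h]
  abel

end SecondFundamentalForm

/-! ### Symmetry of the second fundamental form for torsion-free connections -/

section Symmetry

variable {E' : Type*} [NormedAddCommGroup E'] [NormedSpace ℝ E']
  {P : Type*} [TopologicalSpace P] [ChartedSpace E' P] [IsManifold 𝓘(ℝ, E') ∞ P]
  {E'' : Type*} [NormedAddCommGroup E''] [NormedSpace ℝ E'']
  {M : Type*} [TopologicalSpace M] [ChartedSpace E'' M] [IsManifold 𝓘(ℝ, E'') ∞ M]
  {W : Type*} [NormedAddCommGroup W] [NormedSpace ℝ W]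

lemma tangentCoord_eq_mfderiv {q p : P} (hp : p ∈ (chartAt E' q).source)
    (w : TangentSpace 𝓘(ℝ, E') p) :
    tangentCoord q p w = mvfderiv 𝓘(ℝ, E') (extChartAt 𝓘(ℝ, E') q) p w := by
  have := TangentBundle.continuousLinearMapAt_trivializationAt (I := 𝓘(ℝ, E')) hp
  exact congrArg (fun A : TangentSpace 𝓘(ℝ, E') p →L[ℝ] E' ↦ A w) this

lemma tangentFrame_eq_mfderivWithin {q p : P} (hp : p ∈ (chartAt E' q).source) (e : E') :
    tangentFrame q p e = mfderivWithin 𝓘(ℝ, E') 𝓘(ℝ, E') (extChartAt 𝓘(ℝ, E') q).symm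
      (Set.range 𝓘(ℝ, E')) (extChartAt 𝓘(ℝ, E') q p) e := by
  have := TangentBundle.symmL_trivializationAt (I := 𝓘(ℝ, E')) hp
  exact congrArg (fun A : E' →L[ℝ] TangentSpace 𝓘(ℝ, E') p ↦ A e) this

/-- Read in the chart at `q`, both fields are constant near the image of `q`, so their bracket
vanishes there. -/
lemma mlieBracket_extend (q : P) (u v : TangentSpace 𝓘(ℝ, E') q) :
    VectorField.mlieBracket 𝓘(ℝ, E') (FiberBundle.extend E' u) (FiberBundle.extend E' v) q = 0 := by
  have key : ∀ w : TangentSpace 𝓘(ℝ, E') q,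
      VectorField.mpullbackWithin 𝓘(ℝ, E') 𝓘(ℝ, E') (extChartAt 𝓘(ℝ, E') q).symm
        (FiberBundle.extend E' w) (Set.range 𝓘(ℝ, E'))
      =ᶠ[nhds (extChartAt 𝓘(ℝ, E') q q)] fun _ ↦ tangentCoord q q w := by
    intro w
    filter_upwards [extChartAt_target_mem_nhds (I := 𝓘(ℝ, E')) q] with z hz
    rw [VectorField.mpullbackWithin_apply]
    have hz' : (extChartAt 𝓘(ℝ, E') q).symm z ∈ (chartAt E' q).source := by
      rw [← extChartAt_source 𝓘(ℝ, E')]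
      exact (extChartAt 𝓘(ℝ, E') q).map_target hz
    have h1 := tangentFrame_eq_mfderivWithin hz' (tangentCoord q q w)
    rw [← extend_eq_tangentFrame hz', (extChartAt 𝓘(ℝ, E') q).right_inv hz] at h1
    rw [h1]
    exact (isInvertible_mfderivWithin_extChartAt_symm hz).inverse_apply_eq.2 rfl
  have hz : VectorField.lieBracketWithin ℝ
      (VectorField.mpullbackWithin 𝓘(ℝ, E') 𝓘(ℝ, E') (extChartAt 𝓘(ℝ, E') q).symm
        (FiberBundle.extend E' u) (Set.range 𝓘(ℝ, E')) : E' → E')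
      (VectorField.mpullbackWithin 𝓘(ℝ, E') 𝓘(ℝ, E') (extChartAt 𝓘(ℝ, E') q).symm
        (FiberBundle.extend E' v) (Set.range 𝓘(ℝ, E')) : E' → E')
      ((extChartAt 𝓘(ℝ, E') q).symm ⁻¹' Set.univ ∩ Set.range 𝓘(ℝ, E'))
      (extChartAt 𝓘(ℝ, E') q q) = 0 := by
    refine (Filter.EventuallyEq.lieBracketWithin_vectorField_eq_nhds (key u) (key v)).trans ?_
    simp [VectorField.lieBracketWithin]
  rw [← VectorField.mlieBracketWithin_univ, VectorField.mlieBracketWithin_apply]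
  exact (congrArg _ hz).trans (map_zero _)

lemma cov_extend_symm [FiniteDimensional ℝ E']
    {cov : CovariantDerivative 𝓘(ℝ, E') E' (TangentSpace 𝓘(ℝ, E') : P → Type _)}
    (h : IsConnection cov) (q : P) (u v : TangentSpace 𝓘(ℝ, E') q) :
    cov (FiberBundle.extend E' v) q u = cov (FiberBundle.extend E' u) q v := by
  have := CovariantDerivative.torsion_apply_eq_extend cov u v
  rw [h.torsion_free, mlieBracket_extend, FiberBundle.extend_apply_self,
    FiberBundle.extend_apply_self] at this
  simp only [Pi.zero_apply, zero_apply, sub_zero] at this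
  exact (sub_eq_zero.1 this.symm)

/-- Both sides are values of the second derivative of the chart expression `h` of `G`, which is
symmetric. -/
lemma mvfderiv_differentialForm_extend {G : P → M} (hG : ContMDiff 𝓘(ℝ, E') 𝓘(ℝ, E'') ∞ G) (q : P)
    (u v : TangentSpace 𝓘(ℝ, E') q) :
    mvfderiv 𝓘(ℝ, E') (fun p ↦ differentialForm (E'' := E'') G q p (FiberBundle.extend E' v p)) q u
      = mvfderiv 𝓘(ℝ, E') (fun p ↦ differentialForm (E'' := E'') G q p (FiberBundle.extend E' u p)) q v := by
  let h : E' → E'' :=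
    extChartAt 𝓘(ℝ, E'') (G q) ∘ G ∘ (extChartAt 𝓘(ℝ, E') q).symm
  have hh : ContDiffAt ℝ ∞ h (extChartAt 𝓘(ℝ, E') q q) := by
    have := (contMDiffAt_iff.1 (hG q)).2
    rwa [modelWithCornersSelf_coe, Set.range_id, contDiffWithinAt_univ] at this
  have key : ∀ w : TangentSpace 𝓘(ℝ, E') q,
      (fun p ↦ differentialForm (E'' := E'') G q p (FiberBundle.extend E' w p)) =ᶠ[nhds q]
        fun p ↦ fderiv ℝ h (extChartAt 𝓘(ℝ, E') q p) (tangentCoord q q w) := by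
    intro w
    filter_upwards [chart_source_mem_nhds (E' := E') q,
      hG.continuous.continuousAt.preimage_mem_nhds (chart_source_mem_nhds (E' := E'') (G q))]
      with p hp hp'
    obtain ⟨z, hz, rfl⟩ : ∃ z ∈ (extChartAt 𝓘(ℝ, E') q).target,
        (extChartAt 𝓘(ℝ, E') q).symm z = p := by
      rw [← extChartAt_source 𝓘(ℝ, E')] at hp
      exact ⟨_, (extChartAt 𝓘(ℝ, E') q).map_source hp, (extChartAt 𝓘(ℝ, E') q).left_inv hp⟩
    rw [extend_eq_tangentFrame hp, differentialForm, ContinuousLinearMap.comp_apply,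
      tangentCoord_eq_mfderiv hp', tangentFrame_eq_mfderivWithin hp,
      (extChartAt 𝓘(ℝ, E') q).right_inv hz]
    have hA := (mdifferentiableWithinAt_extChartAt_symm (I := 𝓘(ℝ, E')) hz).hasMFDerivWithinAt
    have hB := (hG.mdifferentiable (by simp)
      ((extChartAt 𝓘(ℝ, E') q).symm z)).hasMFDerivAt
    have hC := (mdifferentiableAt_extChartAt (I := 𝓘(ℝ, E'')) hp').hasMFDerivAt
    -- The model has no boundary: its range is the whole space, so the derivative within the range
    -- is a full derivative.
    have hABC := ((hC.comp _ hB).comp_hasMFDerivWithinAt z hA).hasMFDerivAt (by simp)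
    have heq : ∀ D : E' →L[ℝ] E'', HasMFDerivAt 𝓘(ℝ, E') 𝓘(ℝ, E'') h z D →
        ∀ e, fderiv ℝ h z e = D e :=
      fun D hD e ↦ congrArg (fun A : E' →L[ℝ] E'' ↦ A e) (mfderiv_eq_fderiv.symm.trans hD.mfderiv)
    exact (heq _ hABC _).symm
  have hd : ∀ u w : TangentSpace 𝓘(ℝ, E') q, mvfderiv 𝓘(ℝ, E')
      (fun p ↦ fderiv ℝ h (extChartAt 𝓘(ℝ, E') q p) (tangentCoord q q w)) q u
      = fderiv ℝ (fderiv ℝ h) (extChartAt 𝓘(ℝ, E') q q) (tangentCoord q q u)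
        (tangentCoord q q w) := by
    intro u w
    have h1 : HasFDerivAt (fderiv ℝ h) (fderiv ℝ (fderiv ℝ h) (extChartAt 𝓘(ℝ, E') q q))
        (extChartAt 𝓘(ℝ, E') q q) :=
      ((hh.fderiv_right (m := 1) (by decide)).differentiableAt (by simp)).hasFDerivAt
    have h2 := h1.clm_apply (hasFDerivAt_const (tangentCoord q q w) (extChartAt 𝓘(ℝ, E') q q))
    rw [mvfderiv_comp_fderiv h2 (mdifferentiableAt_extChartAt (mem_chart_source _ _)),
      ← tangentCoord_eq_mfderiv (mem_chart_source _ _)]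
    simp
  rw [mvfderiv_congr (key v), mvfderiv_congr (key u), hd, hd]
  exact (hh.isSymmSndFDerivAt (by simp; decide)) _ _

/-- The Hessian term is symmetric because `G` is smooth, and the connection terms of source and
target because the torsions vanish. -/
lemma secondFundamentalForm_symm [FiniteDimensional ℝ E'] [FiniteDimensional ℝ E'']
    {covP : CovariantDerivative 𝓘(ℝ, E') E' (TangentSpace 𝓘(ℝ, E') : P → Type _)}
    {covM : CovariantDerivative 𝓘(ℝ, E'') E'' (TangentSpace 𝓘(ℝ, E'') : M → Type _)}
    (hP : IsConnection covP) (hM : IsConnection covM)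
    {G : P → M} (hG : ContMDiff 𝓘(ℝ, E') 𝓘(ℝ, E'') ∞ G) (q : P) (u v : TangentSpace 𝓘(ℝ, E') q) :
    secondFundamentalForm covP covM G q u v = secondFundamentalForm covP covM G q v u := by
  rw [secondFundamentalForm_eq _ _ hG.continuous.continuousAt,
    secondFundamentalForm_eq _ _ hG.continuous.continuousAt, covDerivForm, covDerivForm,
    mvfderiv_differentialForm_extend hG, cov_extend_symm hP, cov_extend_symm hM]

end Symmetry

/-! ### Global extension of tangent vectors -/

section GlobalExtension

variable {E : Type*} [NormedAddCommGroup E] [NormedSpace ℝ E] [FiniteDimensional ℝ E]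
  {M : Type*} [TopologicalSpace M] [T2Space M] [ChartedSpace E M] [IsManifold 𝓘(ℝ, E) ∞ M]

/-- Projectability is stated for globally smooth fields, so the local constant-coordinate extension
is cut off by a bump function equal to 1 at `x`. -/
lemma exists_smooth_vectorField (x : M) (v : TangentSpace 𝓘(ℝ, E) x) :
    ∃ X : Π y : M, TangentSpace 𝓘(ℝ, E) y, CMDiff ∞ (T% X) ∧ X x = v := by
  let φ : SmoothBumpFunction 𝓘(ℝ, E) x := Classical.arbitrary _
  refine ⟨(φ : M → ℝ) • FiberBundle.extend E v, ?_, by simp⟩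
  refine ContMDiffOn.smul_section_of_tsupport (u := (chartAt E x).source)
    φ.contMDiff.contMDiffOn (chartAt E x).open_source φ.tsupport_subset_chartAt_source ?_
  intro y hy
  have hy' := mem_baseSet_iff.2 hy
  rw [Trivialization.contMDiffWithinAt_section _ hy']
  refine (contMDiffOn_const (c := tangentCoord x x v)).congr (s := (chartAt E x).source) ?_ y hy
  intro z hz
  rw [← tangentCoord_eq hz, extend_eq_tangentFrame hz, tangentCoord_tangentFrame hz]

end GlobalExtension

/-! ### Kernel and image of the differential of the bundle projection -/

section Principal

variable {EM EP EG : Type*} [NormedAddCommGroup EM] [NormedSpace ℝ EM]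
  [NormedAddCommGroup EP] [NormedSpace ℝ EP] [NormedAddCommGroup EG] [NormedSpace ℝ EG]
  {M P G : Type*} [TopologicalSpace M] [ChartedSpace EM M]
  [TopologicalSpace P] [ChartedSpace EP P]
  [TopologicalSpace G] [ChartedSpace EG G] [Group G]

namespace PrincipalBundle

variable (B : PrincipalBundle EM EP EG M P G)

lemma mdifferentiableAt_proj (p : P) : MDifferentiableAt 𝓘(ℝ, EP) 𝓘(ℝ, EM) B.proj p :=
  B.contMDiff_proj.mdifferentiable (by simp) p

lemma mdifferentiable_act (p : P) :
    MDifferentiable 𝓘(ℝ, EG) 𝓘(ℝ, EP) (fun a : G ↦ B.act p a) := by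
  have h : ContMDiff 𝓘(ℝ, EG) 𝓘(ℝ, EP) ∞ (fun a : G ↦ B.act p a) :=
    B.contMDiff_act.comp (contMDiff_const.prodMk contMDiff_id)
  exact h.mdifferentiable (by simp)

/-- The orbit map followed by the projection is constant. -/
lemma mfderiv_proj_fundamental (p : P) (ξ : GroupLieAlgebra 𝓘(ℝ, EG) G) :
    mfderiv 𝓘(ℝ, EP) 𝓘(ℝ, EM) B.proj p (B.fundamental p ξ) = 0 := by
  -- The chain rule lands at `B.act p 1`, which is only propositionally `p`; a free base point `q`
  -- allows the transport.
  have h : ∀ q, B.act p 1 = q → ∀ ξ : EG, (mfderiv 𝓘(ℝ, EP) 𝓘(ℝ, EM) B.proj q : EP →L[ℝ] EM)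
      ((mfderiv 𝓘(ℝ, EG) 𝓘(ℝ, EP) (fun a : G ↦ B.act p a) 1 : EG →L[ℝ] EP) ξ) = 0 := by
    rintro q rfl ξ
    have h1 := mfderiv_comp (1 : G) (B.mdifferentiableAt_proj (B.act p 1))
      (B.mdifferentiable_act p 1)
    have h2 : B.proj ∘ (fun a : G ↦ B.act p a) = fun _ ↦ B.proj p :=
      funext fun a ↦ B.proj_act p a
    rw [h2, mfderiv_const] at h1
    exact (congrArg (fun A : EG →L[ℝ] EM ↦ A ξ) h1).symm
  exact h p (B.act_one p) ξ

/-- The local trivialization gives a section through `p`; differentiating `π ∘ σ = id` exhibits a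
preimage. -/
lemma mfderiv_proj_surjective (p : P) (v : TangentSpace 𝓘(ℝ, EM) (B.proj p)) :
    ∃ w : TangentSpace 𝓘(ℝ, EP) p, mfderiv 𝓘(ℝ, EP) 𝓘(ℝ, EM) B.proj p w = v := by
  obtain ⟨U, ψ, hU, hx, hs, ht, hψ, hψ', h1, -⟩ := B.locally_trivial (B.proj p)
  have hp : p ∈ ψ.source := by rw [hs]; exact hx
  have hx2 : ∀ x ∈ U, (x, (ψ p).2) ∈ ψ.target := fun x hxU ↦ by rw [ht]; exact ⟨hxU, trivial⟩
  have hpt : ψ.symm (B.proj p, (ψ p).2) = p := by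
    rw [← h1 p hp]; exact ψ.left_inv hp
  have hσ : MDifferentiableAt 𝓘(ℝ, EM) 𝓘(ℝ, EP) (fun x ↦ ψ.symm (x, (ψ p).2)) (B.proj p) := by
    have hd := ((hψ' _ (hx2 _ hx)).contMDiffAt (ψ.open_target.mem_nhds (hx2 _ hx))).mdifferentiableAt
      (by simp)
    exact hd.comp (B.proj p) (mdifferentiableAt_id.prodMk mdifferentiableAt_const)
  have hid : B.proj ∘ (fun x ↦ ψ.symm (x, (ψ p).2)) =ᶠ[nhds (B.proj p)] id := by
    filter_upwards [hU.mem_nhds hx] with x hxU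
    have := h1 _ (ψ.map_target (hx2 x hxU))
    rw [ψ.right_inv (hx2 x hxU)] at this
    exact this.symm
  have h : ∀ q, ψ.symm (B.proj p, (ψ p).2) = q → ∀ v : EM,
      (mfderiv 𝓘(ℝ, EP) 𝓘(ℝ, EM) B.proj q : EP →L[ℝ] EM)
      ((mfderiv 𝓘(ℝ, EM) 𝓘(ℝ, EP) (fun x ↦ ψ.symm (x, (ψ p).2)) (B.proj p) : EM →L[ℝ] EP) v)
        = v := by
    rintro q rfl v
    have h2 := mfderiv_comp (B.proj p) (B.mdifferentiableAt_proj _) hσ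
    rw [hid.mfderiv_eq, mfderiv_id] at h2
    exact (congrArg (fun A : EM →L[ℝ] EM ↦ A v) h2).symm
  exact ⟨_, h p hpt v⟩

/-- In a trivialization a vertical vector has no base component, hence is tangent to the slice `a ↦
ψ⁻¹(π p, a)`. By equivariance this slice is `a ↦ p · (g⁻¹ a)`, the orbit map precomposed with a left
translation. -/
lemma exists_fundamental_eq [LieGroup 𝓘(ℝ, EG) ∞ G] (p : P) (w : TangentSpace 𝓘(ℝ, EP) p)
    (hw : mfderiv 𝓘(ℝ, EP) 𝓘(ℝ, EM) B.proj p w = 0) : ∃ ξ, B.fundamental p ξ = w := by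
  obtain ⟨U, ψ, hU, hx, hs, ht, hψ, hψ', h1, h2⟩ := B.locally_trivial (B.proj p)
  have hp : p ∈ ψ.source := by rw [hs]; exact hx
  set g := (ψ p).2 with hg
  have hact : (fun a : G ↦ ψ.symm (B.proj p, a)) = fun a ↦ B.act p (g⁻¹ * a) := by
    funext a
    have ha : B.act p (g⁻¹ * a) ∈ ψ.source := by
      rw [hs, Set.mem_preimage, B.proj_act]; exact hx
    rw [← ψ.left_inv ha]
    congr 1
    refine Prod.ext ?_ ?_
    · rw [h1 _ ha, B.proj_act]
    · rw [h2 p hp, ← hg]; group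
  have hψd : MDifferentiableAt 𝓘(ℝ, EP) (𝓘(ℝ, EM).prod 𝓘(ℝ, EG)) ψ p :=
    ((hψ p hp).contMDiffAt (ψ.open_source.mem_nhds hp)).mdifferentiableAt (by simp)
  have hψp : ψ p = (B.proj p, g) := Prod.ext (h1 p hp) rfl
  have htp : (B.proj p, g) ∈ ψ.target := by rw [← hψp]; exact ψ.map_source hp
  have hσd : MDifferentiableAt (𝓘(ℝ, EM).prod 𝓘(ℝ, EG)) 𝓘(ℝ, EP) ψ.symm (B.proj p, g) :=
    ((hψ' _ htp).contMDiffAt (ψ.open_target.mem_nhds htp)).mdifferentiableAt (by simp)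
  let D : EP →L[ℝ] EM × EG := mfderiv 𝓘(ℝ, EP) (𝓘(ℝ, EM).prod 𝓘(ℝ, EG)) ψ p
  let S : EM × EG →L[ℝ] EP := mfderiv (𝓘(ℝ, EM).prod 𝓘(ℝ, EG)) 𝓘(ℝ, EP) ψ.symm (B.proj p, g)
  have hSD : ∀ w, S (D w) = w := by
    intro w
    have hσd' : MDifferentiableAt (𝓘(ℝ, EM).prod 𝓘(ℝ, EG)) 𝓘(ℝ, EP) ψ.symm (ψ p) := by
      rwa [hψp]
    have h3 := mfderiv_comp p hσd' hψd
    have h4 : ψ.symm ∘ ψ =ᶠ[nhds p] id := by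
      filter_upwards [ψ.open_source.mem_nhds hp] with q hq using ψ.left_inv hq
    rw [h4.mfderiv_eq, mfderiv_id] at h3
    have h5 := (congrArg (fun A : EP →L[ℝ] EP ↦ A w) h3).symm
    have h6 : ∀ z, ψ p = z → (mfderiv (𝓘(ℝ, EM).prod 𝓘(ℝ, EG)) 𝓘(ℝ, EP) ψ.symm z
      : EM × EG →L[ℝ] EP) (D w) = w := by
      rintro z rfl
      exact h5
    exact h6 _ hψp
  have hD1 : (D w).1 = 0 := by
    have h3 : (fun q ↦ (ψ q).1) =ᶠ[nhds p] B.proj := by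
      filter_upwards [ψ.open_source.mem_nhds hp] with q hq using h1 q hq
    have h4 := mfderiv_comp p (I'' := 𝓘(ℝ, EM)) (g := (Prod.fst : M × G → M))
      mdifferentiableAt_fst hψd
    have h5 : mfderiv 𝓘(ℝ, EP) 𝓘(ℝ, EM) (Prod.fst ∘ ψ) p = mfderiv 𝓘(ℝ, EP) 𝓘(ℝ, EM) B.proj p :=
      h3.mfderiv_eq
    rw [h5, mfderiv_fst] at h4
    have h6 := congrArg (fun A : EP →L[ℝ] EM ↦ A w) h4
    exact h6.symm.trans hw
  have hS : ∀ η : EG, S (0, η)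
      = (mfderiv 𝓘(ℝ, EG) 𝓘(ℝ, EP) (fun a : G ↦ ψ.symm (B.proj p, a)) g : EG →L[ℝ] EP) η := by
    intro η
    have h3 := mfderiv_comp g (f := fun a : G ↦ (B.proj p, a)) hσd
      (mdifferentiableAt_const.prodMk mdifferentiableAt_id)
    have h4 := congrArg (fun A : EG →L[ℝ] EP ↦ A η) h3
    have h5 : (mfderiv 𝓘(ℝ, EG) (𝓘(ℝ, EM).prod 𝓘(ℝ, EG)) (fun a : G ↦ (B.proj p, a)) g
        : EG →L[ℝ] EM × EG) η = (0, η) := by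
      rw [mfderiv_prod_right]; rfl
    refine Eq.trans ?_ h4.symm
    exact (congrArg S h5).symm
  have hL : MDifferentiableAt 𝓘(ℝ, EG) 𝓘(ℝ, EG) (fun a : G ↦ g⁻¹ * a) g :=
    (contMDiff_mul_left (I := 𝓘(ℝ, EG)) (n := ∞) (a := g⁻¹)).mdifferentiable (by simp) g
  let Λ : EG →L[ℝ] EG := mfderiv 𝓘(ℝ, EG) 𝓘(ℝ, EG) (fun a : G ↦ g⁻¹ * a) g
  have hfund : ∀ η : EG,
      (mfderiv 𝓘(ℝ, EG) 𝓘(ℝ, EP) (fun a : G ↦ B.act p (g⁻¹ * a)) g : EG →L[ℝ] EP) η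
      = (mfderiv 𝓘(ℝ, EG) 𝓘(ℝ, EP) (fun a : G ↦ B.act p a) 1 : EG →L[ℝ] EP) (Λ η) := by
    intro η
    have h3 := mfderiv_comp g (B.mdifferentiable_act p (g⁻¹ * g)) hL
    have h4 := congrArg (fun A : EG →L[ℝ] EP ↦ A η) h3
    have h5 : ∀ z, g⁻¹ * g = z →
      (mfderiv 𝓘(ℝ, EG) 𝓘(ℝ, EP) (fun a : G ↦ B.act p (g⁻¹ * a)) g : EG →L[ℝ] EP) η
      = (mfderiv 𝓘(ℝ, EG) 𝓘(ℝ, EP) (fun a : G ↦ B.act p a) z : EG →L[ℝ] EP) (Λ η) := by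
      rintro z rfl
      exact h4
    exact h5 1 (inv_mul_cancel g)
  -- The generator is the group component of `w`, moved from `g` to the identity by left
  -- translation.
  refine ⟨Λ (D w).2, ?_⟩
  have h7 : D w = (0, (D w).2) := Prod.ext hD1 rfl
  have h8 := hS (D w).2
  rw [← h7, hSD w, hact] at h8
  exact (h8.trans (hfund _)).symm

end PrincipalBundle

end Principal

/-! ### Polarization of the second fundamental form -/

section SecondFundamentalFormAdd

variable {E' : Type*} [NormedAddCommGroup E'] [NormedSpace ℝ E'] [FiniteDimensional ℝ E']
  {P : Type*} [TopologicalSpace P] [ChartedSpace E' P] [IsManifold 𝓘(ℝ, E') ∞ P]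
  {E'' : Type*} [NormedAddCommGroup E''] [NormedSpace ℝ E''] [FiniteDimensional ℝ E'']
  {M : Type*} [TopologicalSpace M] [ChartedSpace E'' M] [IsManifold 𝓘(ℝ, E'') ∞ M]
  {covP : CovariantDerivative 𝓘(ℝ, E') E' (TangentSpace 𝓘(ℝ, E') : P → Type _)}
  {covM : CovariantDerivative 𝓘(ℝ, E'') E'' (TangentSpace 𝓘(ℝ, E'') : M → Type _)}
  {G : P → M}

omit [FiniteDimensional ℝ E'] [FiniteDimensional ℝ E''] in
lemma secondFundamentalForm_add_left {q : P} (hG : ContinuousAt G q)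
    (u u' v : TangentSpace 𝓘(ℝ, E') q) :
    secondFundamentalForm covP covM G q (u + u') v
      = secondFundamentalForm covP covM G q u v + secondFundamentalForm covP covM G q u' v := by
  rw [secondFundamentalForm_eq _ _ hG, secondFundamentalForm_eq _ _ hG,
    secondFundamentalForm_eq _ _ hG]
  simp only [covDerivForm, map_add, map_sub]
  abel

/-- Symmetry is used twice: it carries additivity from the first slot to the second, and it merges
the two cross terms. -/
lemma secondFundamentalForm_add_self (hP : IsConnection covP) (hM : IsConnection covM)
    (hG : ContMDiff 𝓘(ℝ, E') 𝓘(ℝ, E'') ∞ G) (q : P) (u v : TangentSpace 𝓘(ℝ, E') q) :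
    secondFundamentalForm covP covM G q (u + v) (u + v)
      = secondFundamentalForm covP covM G q u u
        + (2 : ℝ) • secondFundamentalForm covP covM G q u v
        + secondFundamentalForm covP covM G q v v := by
  have hc := hG.continuous.continuousAt (x := q)
  rw [secondFundamentalForm_add_left hc, secondFundamentalForm_symm hP hM hG q u (u + v),
    secondFundamentalForm_symm hP hM hG q v (u + v), secondFundamentalForm_add_left hc,
    secondFundamentalForm_add_left hc, secondFundamentalForm_symm hP hM hG q v u, two_smul]
  abel

end SecondFundamentalFormAdd

/-! ### The splitting given by a connection form, and horizontal lifts -/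

section Principal


lemma isInvertible_of_bijective {V W : Type*} [NormedAddCommGroup V] [NormedSpace ℝ V]
    [FiniteDimensional ℝ V] [NormedAddCommGroup W] [NormedSpace ℝ W] {L : V →L[ℝ] W}
    (h : Function.Bijective L) : L.IsInvertible := by
  let e := LinearEquiv.ofBijective (L : V →ₗ[ℝ] W) h
  have : FiniteDimensional ℝ W := e.finiteDimensional
  exact ⟨e.toContinuousLinearEquiv, by ext; rfl⟩

variable {EM EP EG : Type*} [NormedAddCommGroup EM] [NormedSpace ℝ EM]
  [NormedAddCommGroup EP] [NormedSpace ℝ EP] [NormedAddCommGroup EG] [NormedSpace ℝ EG]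
  {M P G : Type*} [TopologicalSpace M] [ChartedSpace EM M]
  [TopologicalSpace P] [ChartedSpace EP P]
  [TopologicalSpace G] [ChartedSpace EG G] [Group G]
  [IsManifold 𝓘(ℝ, EP) ∞ P]
  {B : PrincipalBundle EM EP EG M P G}

namespace ConnectionForm

variable (θ : ConnectionForm B)

lemma form_ver (p : P) (u : TangentSpace 𝓘(ℝ, EP) p) : θ.form p (θ.ver p u) = θ.form p u :=
  θ.form_fundamental p _

lemma form_hor (p : P) (u : TangentSpace 𝓘(ℝ, EP) p) : θ.form p (θ.hor p u) = 0 := by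
  rw [hor, map_sub, form_ver, sub_self]

lemma mfderiv_proj_ver (p : P) (u : TangentSpace 𝓘(ℝ, EP) p) :
    mfderiv 𝓘(ℝ, EP) 𝓘(ℝ, EM) B.proj p (θ.ver p u) = 0 :=
  B.mfderiv_proj_fundamental p _

lemma mfderiv_proj_hor (p : P) (u : TangentSpace 𝓘(ℝ, EP) p) :
    mfderiv 𝓘(ℝ, EP) 𝓘(ℝ, EM) B.proj p (θ.hor p u) = mfderiv 𝓘(ℝ, EP) 𝓘(ℝ, EM) B.proj p u := by
  rw [hor, map_sub, mfderiv_proj_ver, sub_zero]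

lemma hor_add_ver (p : P) (u : TangentSpace 𝓘(ℝ, EP) p) : θ.hor p u + θ.ver p u = u :=
  sub_add_cancel _ _

/-- Any preimage of `v` under `π_*` can be corrected by a fundamental vector, which `π_*` does not
see. -/
lemma exists_mfderiv_proj_form_eq (p : P) (v : TangentSpace 𝓘(ℝ, EM) (B.proj p))
    (ξ : GroupLieAlgebra 𝓘(ℝ, EG) G) : ∃ w : TangentSpace 𝓘(ℝ, EP) p,
      mfderiv 𝓘(ℝ, EP) 𝓘(ℝ, EM) B.proj p w = v ∧ θ.form p w = ξ := by
  obtain ⟨w, hw⟩ := B.mfderiv_proj_surjective p v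
  refine ⟨w + B.fundamental p (ξ - θ.form p w), ?_, ?_⟩
  · rw [map_add, hw, B.mfderiv_proj_fundamental, add_zero]
  · rw [map_add, θ.form_fundamental]; abel

variable [LieGroup 𝓘(ℝ, EG) ∞ G]

lemma eq_zero_of_mfderiv_proj_of_form {p : P} {w : TangentSpace 𝓘(ℝ, EP) p}
    (h1 : mfderiv 𝓘(ℝ, EP) 𝓘(ℝ, EM) B.proj p w = 0) (h2 : θ.form p w = 0) : w = 0 := by
  obtain ⟨ξ, rfl⟩ := B.exists_fundamental_eq p w h1
  rw [θ.form_fundamental] at h2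
  rw [h2, map_zero]

variable [FiniteDimensional ℝ EP]

/-- Since `inverse` is zero on non-invertible maps, the definition of `lift` acquires its meaning
here. -/
lemma isInvertible_mfderiv_proj_prod_form (p : P) :
    ((mfderiv 𝓘(ℝ, EP) 𝓘(ℝ, EM) B.proj p).prod (θ.form p)).IsInvertible := by
  refine isInvertible_of_bijective (V := EP) (W := EM × EG)
    (L := (mfderiv 𝓘(ℝ, EP) 𝓘(ℝ, EM) B.proj p).prod (θ.form p)) ⟨?_, ?_⟩
  · refine (injective_iff_map_eq_zero _).2 fun w hw ↦ ?_
    exact θ.eq_zero_of_mfderiv_proj_of_form (congrArg Prod.fst hw) (congrArg Prod.snd hw)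
  · rintro ⟨v, ξ⟩
    obtain ⟨w, h1, h2⟩ := θ.exists_mfderiv_proj_form_eq p v ξ
    exact ⟨w, Prod.ext h1 h2⟩

lemma lift_eq {p : P} {v : TangentSpace 𝓘(ℝ, EM) (B.proj p)} {w : TangentSpace 𝓘(ℝ, EP) p}
    (h1 : mfderiv 𝓘(ℝ, EP) 𝓘(ℝ, EM) B.proj p w = v) (h2 : θ.form p w = 0) : θ.lift p v = w := by
  rw [lift, (θ.isInvertible_mfderiv_proj_prod_form p).inverse_apply_eq]
  exact Prod.ext h1.symm h2.symm

lemma mfderiv_proj_lift (p : P) (v : TangentSpace 𝓘(ℝ, EM) (B.proj p)) :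
    mfderiv 𝓘(ℝ, EP) 𝓘(ℝ, EM) B.proj p (θ.lift p v) = v := by
  obtain ⟨w, h1, h2⟩ := θ.exists_mfderiv_proj_form_eq p v 0
  rw [θ.lift_eq h1 h2, h1]

lemma form_lift (p : P) (v : TangentSpace 𝓘(ℝ, EM) (B.proj p)) : θ.form p (θ.lift p v) = 0 := by
  obtain ⟨w, h1, h2⟩ := θ.exists_mfderiv_proj_form_eq p v 0
  rw [θ.lift_eq h1 h2, h2]

lemma lift_mfderiv_proj (p : P) (u : TangentSpace 𝓘(ℝ, EP) p) :
    θ.lift p (mfderiv 𝓘(ℝ, EP) 𝓘(ℝ, EM) B.proj p u) = θ.hor p u :=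
  θ.lift_eq (θ.mfderiv_proj_hor p u) (θ.form_hor p u)

/-- The connection form with values in the model space of the group. -/
def modelForm (p : P) : TangentSpace 𝓘(ℝ, EP) p →L[ℝ] EG := θ.form p

omit [LieGroup 𝓘(ℝ, EG) ∞ G] in
lemma mdifferentiableAt_modelForm (q : P) :
    MDifferentiableAt 𝓘(ℝ, EP) 𝓘(ℝ, EP →L[ℝ] EG)
      (fun p ↦ (θ.modelForm p).comp (tangentFrame q p)) q := by
  refine mdifferentiableAt_form_comp_tangentFrame (α := θ.modelForm) fun X hX ↦ ?_
  exact (θ.smooth.mdifferentiable (by simp) _).comp q hX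

variable [IsManifold 𝓘(ℝ, EM) ∞ M]

/-- In coordinates the lift solves a linear system whose matrix `Φ` is differentiable and invertible
near `q`, and inversion is smooth at invertible operators. Here `V` is any field along `π`, so the
lemma covers both `Y ∘ π` and `π_* X`, the latter giving horizontal parts. -/
lemma mdifferentiableAt_lift {V : Π p : P, TangentSpace 𝓘(ℝ, EM) (B.proj p)} {q : P}
    (hV : MDifferentiableAt 𝓘(ℝ, EP) 𝓘(ℝ, EM)
      (fun p ↦ tangentCoord (B.proj q) (B.proj p) (V p)) q) :
    MDiffAt (T% (fun p ↦ θ.lift p (V p))) q := by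
  rw [mdifferentiableAt_section_iff_tangentCoord]
  let Φ : P → EP →L[ℝ] EM × EG := fun p ↦
    ((differentialForm B.proj q p).comp (tangentFrame q p)).prod
      ((θ.modelForm p).comp (tangentFrame q p))
  have hΦd : MDifferentiableAt 𝓘(ℝ, EP) 𝓘(ℝ, EP →L[ℝ] EM × EG) Φ q := by
    refine mdifferentiableAt_clm_of_apply fun e ↦ ?_
    exact ((mdifferentiableAt_differentialForm B.contMDiff_proj q).clm_apply
      mdifferentiableAt_const).prodMk_space
      ((θ.mdifferentiableAt_modelForm q).clm_apply mdifferentiableAt_const)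
  have hnhds : ∀ᶠ p in nhds q, p ∈ (chartAt EP q).source ∧
      B.proj p ∈ (chartAt EM (B.proj q)).source :=
    Filter.Eventually.and (chart_source_mem_nhds (E' := EP) q)
      ((B.mdifferentiableAt_proj q).continuousAt.preimage_mem_nhds
        (chart_source_mem_nhds (E' := EM) (B.proj q)))
  have hΦ : ∀ p, p ∈ (chartAt EP q).source → B.proj p ∈ (chartAt EM (B.proj q)).source →
      (Φ p).IsInvertible := by
    intro p hp hp'
    refine isInvertible_of_bijective ⟨(injective_iff_map_eq_zero _).2 fun e he ↦ ?_, ?_⟩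
    · have h1 : tangentCoord (B.proj q) (B.proj p)
        (mfderiv 𝓘(ℝ, EP) 𝓘(ℝ, EM) B.proj p (tangentFrame q p e)) = 0 := congrArg Prod.fst he
      have h2 : θ.form p (tangentFrame q p e) = 0 := congrArg Prod.snd he
      have h3 := congrArg (tangentFrame (B.proj q) (B.proj p)) h1
      rw [tangentFrame_tangentCoord hp', map_zero] at h3
      have h4 := congrArg (tangentCoord q p) (θ.eq_zero_of_mfderiv_proj_of_form h3 h2)
      rwa [tangentCoord_tangentFrame hp, map_zero] at h4
    · rintro ⟨v, ξ⟩
      obtain ⟨w, h1, h2⟩ := θ.exists_mfderiv_proj_form_eq p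
        (tangentFrame (B.proj q) (B.proj p) v) ξ
      refine ⟨tangentCoord q p w, Prod.ext ?_ ?_⟩
      · change tangentCoord (B.proj q) (B.proj p) (mfderiv 𝓘(ℝ, EP) 𝓘(ℝ, EM) B.proj p
          (tangentFrame q p (tangentCoord q p w))) = v
        rw [tangentFrame_tangentCoord hp, h1, tangentCoord_tangentFrame hp']
      · change θ.form p (tangentFrame q p (tangentCoord q p w)) = ξ
        rw [tangentFrame_tangentCoord hp, h2]
  have hinv : MDifferentiableAt 𝓘(ℝ, EP) 𝓘(ℝ, EM × EG →L[ℝ] EP) (fun p ↦ (Φ p).inverse) q := by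
    have hq := hΦ q (mem_chart_source _ _) (mem_chart_source _ _)
    have := FiniteDimensional.complete ℝ EP
    have hc : ContDiffAt ℝ 1 ContinuousLinearMap.inverse (Φ q) := hq.contDiffAt_map_inverse
    exact (hc.differentiableAt (by simp)).comp_mdifferentiableAt hΦd
  have hz : MDifferentiableAt 𝓘(ℝ, EP) 𝓘(ℝ, EM × EG)
      (fun p ↦ (tangentCoord (B.proj q) (B.proj p) (V p), (0 : EG))) q :=
    hV.prodMk_space mdifferentiableAt_const
  refine (hinv.clm_apply hz).congr_of_eventuallyEq ?_
  filter_upwards [hnhds] with p hp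
  symm
  rw [(hΦ p hp.1 hp.2).inverse_apply_eq]
  refine Prod.ext ?_ ?_
  · change _ = tangentCoord (B.proj q) (B.proj p) (mfderiv 𝓘(ℝ, EP) 𝓘(ℝ, EM) B.proj p
      (tangentFrame q p (tangentCoord q p (θ.lift p (V p)))))
    rw [tangentFrame_tangentCoord hp.1, mfderiv_proj_lift]
  · change _ = θ.form p (tangentFrame q p (tangentCoord q p (θ.lift p (V p))))
    rw [tangentFrame_tangentCoord hp.1, form_lift]
    rfl

lemma mdifferentiableAt_hor {X : Π p : P, TangentSpace 𝓘(ℝ, EP) p} {q : P}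
    (hX : MDiffAt (T% X) q) : MDiffAt (T% (fun p ↦ θ.hor p (X p))) q := by
  have := θ.mdifferentiableAt_lift (mdifferentiableAt_pushforward B.contMDiff_proj hX)
  simpa only [lift_mfderiv_proj] using this

lemma mdifferentiableAt_ver {X : Π p : P, TangentSpace 𝓘(ℝ, EP) p} {q : P}
    (hX : MDiffAt (T% X) q) : MDiffAt (T% (fun p ↦ θ.ver p (X p))) q := by
  have h := mdifferentiableAt_sub_section hX (θ.mdifferentiableAt_hor hX)
  have h2 : (X - fun p ↦ θ.hor p (X p)) = fun p ↦ θ.ver p (X p) := by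
    funext p
    exact sub_sub_cancel _ _
  rwa [h2] at h

end ConnectionForm

end Principal

/-! ### The second fundamental form of the bundle projection -/

section Principal

variable {EM EP EG : Type*} [NormedAddCommGroup EM] [NormedSpace ℝ EM] [FiniteDimensional ℝ EM]
  [NormedAddCommGroup EP] [NormedSpace ℝ EP] [FiniteDimensional ℝ EP]
  [NormedAddCommGroup EG] [NormedSpace ℝ EG]
  {M P G : Type*} [TopologicalSpace M] [T2Space M] [ChartedSpace EM M] [IsManifold 𝓘(ℝ, EM) ∞ M]
  [TopologicalSpace P] [ChartedSpace EP P] [IsManifold 𝓘(ℝ, EP) ∞ P]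
  [TopologicalSpace G] [ChartedSpace EG G] [Group G] [LieGroup 𝓘(ℝ, EG) ∞ G]
  {B : PrincipalBundle EM EP EG M P G}

namespace ConnectionForm

variable (θ : ConnectionForm B)
  {covP : CovariantDerivative 𝓘(ℝ, EP) EP (TangentSpace 𝓘(ℝ, EP) : P → Type _)}
  {covM : CovariantDerivative 𝓘(ℝ, EM) EM (TangentSpace 𝓘(ℝ, EM) : M → Type _)}

omit [T2Space M] in
-- `β_π` is computed with the vertical field itself: its image under `π_*` is the zero field along
-- `π`, so only the term `-π_* ∇` remains.
lemma secondFundamentalForm_proj_ver (p : P) (w u : TangentSpace 𝓘(ℝ, EP) p) :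
    secondFundamentalForm covP covM B.proj p w (θ.ver p u)
      = -mfderiv 𝓘(ℝ, EP) 𝓘(ℝ, EM) B.proj p
        (covP (fun q ↦ θ.ver q (FiberBundle.extend EP u q)) p w) := by
  have hX := θ.mdifferentiableAt_ver (mdifferentiableAt_extend p u)
  have h := secondFundamentalForm_eq_pullbackCov_sub covP covM B.contMDiff_proj hX w
  simp only [mfderiv_proj_ver, FiberBundle.extend_apply_self] at h
  have h2 := pullbackCov_comp covM (F := B.proj) (x := p) (X := 0) (B.mdifferentiableAt_proj p)
    (mdifferentiableAt_zeroSection ..) w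
  rw [CovariantDerivative.zero] at h2
  rw [h]
  refine (congrArg (· - _) h2).trans ?_
  exact zero_sub _

/-- `β_π` is computed with the horizontal lift of a global field `Y` extending `π_* u`. Both of its
terms are then `∇^M Y` in the direction `π_* u`, the second one by projectability. -/
lemma secondFundamentalForm_proj_hor_hor (hproj : θ.IsProjectable covP covM) (p : P)
    (u : TangentSpace 𝓘(ℝ, EP) p) :
    secondFundamentalForm covP covM B.proj p (θ.hor p u) (θ.hor p u) = 0 := by
  obtain ⟨Y, hY, hYp⟩ := exists_smooth_vectorField (B.proj p)
    (mfderiv 𝓘(ℝ, EP) 𝓘(ℝ, EM) B.proj p u)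
  have hYd : MDiffAt (T% Y) (B.proj p) := hY.mdifferentiable (by simp) _
  have hV : MDifferentiableAt 𝓘(ℝ, EP) 𝓘(ℝ, EM)
      (fun q ↦ tangentCoord (B.proj p) (B.proj q) (Y (B.proj q))) p :=
    (mdifferentiableAt_section_iff_tangentCoord.1 hYd).comp p (B.mdifferentiableAt_proj p)
  have hZ := θ.mdifferentiableAt_lift hV
  have h := secondFundamentalForm_eq_pullbackCov_sub covP covM B.contMDiff_proj hZ (θ.hor p u)
  simp only [mfderiv_proj_lift, hYp, lift_mfderiv_proj] at h
  have h1 := hproj.projection Y Y hY hY p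
  rw [hYp, lift_mfderiv_proj] at h1
  have h2 := congrArg (mfderiv 𝓘(ℝ, EP) 𝓘(ℝ, EM) B.proj p) h1
  rw [mfderiv_proj_hor, mfderiv_proj_lift] at h2
  rw [h, h2, pullbackCov_comp covM (B.mdifferentiableAt_proj p) hYd, mfderiv_proj_hor, sub_self]

omit [T2Space M] [IsManifold 𝓘(ℝ, EM) ∞ M] [FiniteDimensional ℝ EM] [FiniteDimensional ℝ EP]
  [LieGroup 𝓘(ℝ, EG) ∞ G] in
-- On the diagonal the symmetric part is `A` itself, and `π_*` kills its vertical summand.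
lemma mfderiv_proj_symA_self (p : P) (u : TangentSpace 𝓘(ℝ, EP) p) :
    mfderiv 𝓘(ℝ, EP) 𝓘(ℝ, EM) B.proj p (θ.symA covP p u u)
      = mfderiv 𝓘(ℝ, EP) 𝓘(ℝ, EM) B.proj p
        (covP (fun q ↦ θ.ver q (FiberBundle.extend EP u q)) p (θ.hor p u)) := by
  rw [symA, ← two_smul ℝ, smul_smul, inv_mul_cancel₀ two_ne_zero, one_smul, tensorA, map_add,
    mfderiv_proj_ver, mfderiv_proj_hor, zero_add]

omit [T2Space M] [IsManifold 𝓘(ℝ, EM) ∞ M] [FiniteDimensional ℝ EM] [FiniteDimensional ℝ EP]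
  [LieGroup 𝓘(ℝ, EG) ∞ G] in
lemma mfderiv_proj_symT_self (p : P) (u : TangentSpace 𝓘(ℝ, EP) p) :
    mfderiv 𝓘(ℝ, EP) 𝓘(ℝ, EM) B.proj p (θ.symT covP p u u)
      = mfderiv 𝓘(ℝ, EP) 𝓘(ℝ, EM) B.proj p
        (covP (fun q ↦ θ.ver q (FiberBundle.extend EP u q)) p (θ.ver p u)) := by
  rw [symT, ← two_smul ℝ, smul_smul, inv_mul_cancel₀ two_ne_zero, one_smul, tensorT, map_add,
    mfderiv_proj_ver, mfderiv_proj_hor, add_zero]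

/-- The quadratic form of the second fundamental form of the bundle projection. -/
lemma secondFundamentalForm_proj_self (hP : IsConnection covP) (hM : IsConnection covM)
    (hproj : θ.IsProjectable covP covM) (p : P) (u : TangentSpace 𝓘(ℝ, EP) p) :
    secondFundamentalForm covP covM B.proj p u u
      = -mfderiv 𝓘(ℝ, EP) 𝓘(ℝ, EM) B.proj p
        ((2 : ℝ) • θ.symA covP p u u + θ.symT covP p u u) := by
  -- The vertical vector stands in the second slot, so the cross term differentiates a vertical
  -- field in a horizontal direction, as in `A`.
  have h := secondFundamentalForm_add_self hP hM B.contMDiff_proj p (θ.hor p u) (θ.ver p u)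
  rw [hor_add_ver, θ.secondFundamentalForm_proj_hor_hor hproj, θ.secondFundamentalForm_proj_ver,
    θ.secondFundamentalForm_proj_ver] at h
  rw [h, map_add, map_smul, mfderiv_proj_symA_self, mfderiv_proj_symT_self, smul_neg, zero_add,
    neg_add]

end ConnectionForm

/-! ### Traces along a map into the bundle -/

section Map

variable {EN : Type*} [NormedAddCommGroup EN] [NormedSpace ℝ EN]
  {N : Type*} [TopologicalSpace N] [ChartedSpace EN N] [IsManifold 𝓘(ℝ, EN) ∞ N]

omit [T2Space M] [IsManifold 𝓘(ℝ, EM) ∞ M] [FiniteDimensional ℝ EM]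
  [LieGroup 𝓘(ℝ, EG) ∞ G] in
-- The Leibniz rule applied to `F_*` of the extension of `v`; subtracting `ω(F_* ∇v)` turns the
-- pullback derivative into `β_F`.
lemma ConnectionForm.covDerivForm_pullback (θ : ConnectionForm B)
    (covP : CovariantDerivative 𝓘(ℝ, EP) EP (TangentSpace 𝓘(ℝ, EP) : P → Type _))
    (covN : CovariantDerivative 𝓘(ℝ, EN) EN (TangentSpace 𝓘(ℝ, EN) : N → Type _))
    {F : N → P} (hF : ContMDiff 𝓘(ℝ, EN) 𝓘(ℝ, EP) ∞ F) (x : N) (u v : TangentSpace 𝓘(ℝ, EN) x) :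
    covDerivForm covN (θ.pullback F) x u v
      = θ.covDeriv covP (F x) (mfderiv 𝓘(ℝ, EN) 𝓘(ℝ, EP) F x u)
          (mfderiv 𝓘(ℝ, EN) 𝓘(ℝ, EP) F x v)
        + θ.modelForm (F x) (secondFundamentalForm covN covP F x u v) := by
  have h := mvfderiv_form_apply covP (α := θ.modelForm) (hF.mdifferentiable (by simp) x)
    (mdifferentiableAt_pushforward hF (mdifferentiableAt_extend x v))
    (θ.mdifferentiableAt_modelForm (F x)) u
  rw [FiberBundle.extend_apply_self] at h
  have h1 : covDerivForm covN (θ.pullback F) x u v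
      = mvfderiv 𝓘(ℝ, EN) (fun y ↦ θ.modelForm (F y)
          (mfderiv 𝓘(ℝ, EN) 𝓘(ℝ, EP) F y (FiberBundle.extend EN v y))) x u
        - θ.modelForm (F x) (mfderiv 𝓘(ℝ, EN) 𝓘(ℝ, EP) F x
          (covN (FiberBundle.extend EN v) x u)) := rfl
  rw [h1, h, secondFundamentalForm, map_sub, ← add_sub_assoc]
  rfl

variable [FiniteDimensional ℝ EN]
  (g : ContMDiffRiemannianMetric 𝓘(ℝ, EN) ∞ EN (TangentSpace 𝓘(ℝ, EN) : N → Type _))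

omit [T2Space M] [IsManifold 𝓘(ℝ, EM) ∞ M] [FiniteDimensional ℝ EM]
  [LieGroup 𝓘(ℝ, EG) ∞ G] in
lemma ConnectionForm.dStar_pullback (θ : ConnectionForm B)
    (covP : CovariantDerivative 𝓘(ℝ, EP) EP (TangentSpace 𝓘(ℝ, EP) : P → Type _))
    {F : N → P} (hF : ContMDiff 𝓘(ℝ, EN) 𝓘(ℝ, EP) ∞ F) (x : N) :
    dStar g (θ.pullback F) x
      = metricTrace g x (fun u v ↦ θ.covDeriv covP (F x) (mfderiv 𝓘(ℝ, EN) 𝓘(ℝ, EP) F x u)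
          (mfderiv 𝓘(ℝ, EN) 𝓘(ℝ, EP) F x v))
        + θ.modelForm (F x) (tensionField g covP F x) := by
  simp only [dStar, tensionField, metricTrace, map_sum, ← Finset.sum_add_distrib]
  exact Finset.sum_congr rfl fun i _ ↦ θ.covDerivForm_pullback covP _ hF x _ _

/-- The tension field of the projection of a map to the base. -/
lemma ConnectionForm.tensionField_proj_comp (θ : ConnectionForm B)
    {covP : CovariantDerivative 𝓘(ℝ, EP) EP (TangentSpace 𝓘(ℝ, EP) : P → Type _)}
    {covM : CovariantDerivative 𝓘(ℝ, EM) EM (TangentSpace 𝓘(ℝ, EM) : M → Type _)}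
    (hP : IsConnection covP) (hM : IsConnection covM) (hproj : θ.IsProjectable covP covM)
    {F : N → P} (hF : ContMDiff 𝓘(ℝ, EN) 𝓘(ℝ, EP) ∞ F) (x : N) :
    tensionField g covM (B.proj ∘ F) x
      = mfderiv 𝓘(ℝ, EP) 𝓘(ℝ, EM) B.proj (F x) (tensionField g covP F x)
        + -metricTrace g x (fun u v ↦ mfderiv 𝓘(ℝ, EP) 𝓘(ℝ, EM) B.proj (F x)
          ((2 : ℝ) • θ.symA covP (F x) (mfderiv 𝓘(ℝ, EN) 𝓘(ℝ, EP) F x u)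
              (mfderiv 𝓘(ℝ, EN) 𝓘(ℝ, EP) F x v)
            + θ.symT covP (F x) (mfderiv 𝓘(ℝ, EN) 𝓘(ℝ, EP) F x u)
              (mfderiv 𝓘(ℝ, EN) 𝓘(ℝ, EP) F x v))) := by
  simp only [tensionField, metricTrace, map_sum]
  rw [← Finset.sum_neg_distrib]
  refine Eq.trans ?_ Finset.sum_add_distrib
  refine Finset.sum_congr rfl fun i _ ↦ ?_
  -- The trace evaluates only on pairs of equal vectors, so the diagonal values of `β_π` suffice.
  rw [← θ.secondFundamentalForm_proj_self hP hM hproj]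
  exact secondFundamentalForm_comp _ covP covM hF B.contMDiff_proj x _ _

end Map

end Principal

end PrincipalHarmonic

end

theorem theorem2
    {EM EP EG EN : Type*}
    [NormedAddCommGroup EM] [NormedSpace ℝ EM] [FiniteDimensional ℝ EM]
    [NormedAddCommGroup EP] [NormedSpace ℝ EP] [FiniteDimensional ℝ EP]
    [NormedAddCommGroup EG] [NormedSpace ℝ EG] [FiniteDimensional ℝ EG]
    [NormedAddCommGroup EN] [NormedSpace ℝ EN] [FiniteDimensional ℝ EN]
    {M P G N : Type*}
    [TopologicalSpace M] [T2Space M] [ChartedSpace EM M] [IsManifold 𝓘(ℝ, EM) ∞ M]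
    [TopologicalSpace P] [T2Space P] [ChartedSpace EP P] [IsManifold 𝓘(ℝ, EP) ∞ P]
    [TopologicalSpace G] [T2Space G] [ChartedSpace EG G] [Group G] [LieGroup 𝓘(ℝ, EG) ∞ G]
    [TopologicalSpace N] [T2Space N] [ChartedSpace EN N] [IsManifold 𝓘(ℝ, EN) ∞ N]
    (B : PrincipalBundle EM EP EG M P G) (θ : ConnectionForm B)
    (covP : CovariantDerivative 𝓘(ℝ, EP) EP (TangentSpace 𝓘(ℝ, EP) : P → Type _))
    (hP : IsConnection covP)
    (covM : CovariantDerivative 𝓘(ℝ, EM) EM (TangentSpace 𝓘(ℝ, EM) : M → Type _))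
    (hM : IsConnection covM)
    (hproj : θ.IsProjectable covP covM)
    (g : ContMDiffRiemannianMetric 𝓘(ℝ, EN) ∞ EN (TangentSpace 𝓘(ℝ, EN) : N → Type _))
    (F : N → P) (hF : ContMDiff 𝓘(ℝ, EN) 𝓘(ℝ, EP) ∞ F) :
    IsHarmonic g covP F ↔
      (∀ x : N, dStar g (θ.pullback F) x = metricTrace g x (fun u v ↦
        θ.covDeriv covP (F x) (mfderiv 𝓘(ℝ, EN) 𝓘(ℝ, EP) F x u)
          (mfderiv 𝓘(ℝ, EN) 𝓘(ℝ, EP) F x v))) ∧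
      (∀ x : N, tensionField g covM (B.proj ∘ F) x = -metricTrace g x (fun u v ↦
        mfderiv 𝓘(ℝ, EP) 𝓘(ℝ, EM) B.proj (F x)
          ((2 : ℝ) • θ.symA covP (F x) (mfderiv 𝓘(ℝ, EN) 𝓘(ℝ, EP) F x u)
              (mfderiv 𝓘(ℝ, EN) 𝓘(ℝ, EP) F x v)
            + θ.symT covP (F x) (mfderiv 𝓘(ℝ, EN) 𝓘(ℝ, EP) F x u)
              (mfderiv 𝓘(ℝ, EN) 𝓘(ℝ, EP) F x v)))) := by
  have hθ : ∀ x, dStar g (θ.pullback F) x = _ := θ.dStar_pullback g covP hF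
  have hπ := θ.tensionField_proj_comp g hP hM hproj hF
  constructor
  · intro h
    refine ⟨fun x ↦ ?_, fun x ↦ ?_⟩
    · rw [hθ, h x, map_zero, add_zero]
    · refine (hπ x).trans ?_
      rw [h x, map_zero, zero_add]
  · rintro ⟨h1, h2⟩ x
    -- Injectivity of `(π_*, ω)`: each equation, compared with its trace identity, annihilates one
    -- component of `τ_F`.
    refine θ.eq_zero_of_mfderiv_proj_of_form ?_ ?_
    · exact add_eq_right.1 ((hπ x).symm.trans (h2 x))
    · exact add_eq_left.1 ((hθ x).symm.trans (h1 x))
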